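/- For $j\ge 0$ let $L_j(\lambda)=[\,0\ \ I_j\,]-\lambda\,[\,I_j\ \ 0\,]$, a pencil of size $j\times(j+1)$. A Kronecker canonical form is a pencil $\operatorname{diag}(R(\lambda),S(\lambda))$ with $$R(\lambda)=\begin{bmatrix}J-\lambda I_r&0\\0&I_s-\lambda N\end{bmatrix},\qquad S(\lambda)=\operatorname{diag}\big(L_{m_1}(\lambda),\dots,L_{m_p}(\lambda),\,L_{n_1}(\lambda)^\top,\dots,L_{n_\ell}(\lambda)^\top\big),$$ where $J$ and $N$ are complex matrices in Jordan normal form, $N$ is nilpotent, and $m_i\ge0$, $n_i\ge 0$. It is a Kronecker canonical form of an $n\times m$ pencil $A-\lambda B$ if it equals $P(A-\lambda B)Q$ for some nonsingular $P\in\mathbb C^{n\times n}$, $Q\in\mathbb C^{m\times m}$; then $R$ and $S$ are called the regular and the singular part of $A-\lambda B$, and $n_1,\dots,n_\ell$ its left minimal indices. A set $\Omega\subseteq\mathbb C^{n\times k}\cong\mathbb C^{nk}$ is called generic if its complement is contained in a proper algebraic subset, i.e. in the set of common zeros of finitely many complex polynomials in $nk$ variables, this set of zeros not being all of $\mathbb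 C^{nk}$. Let $A,B\in\mathbb C^{n\times m}$. Then the pencil $A-\lambda B$ has a Kronecker canonical form. Let $\operatorname{diag}(R(\lambda),S(\lambda))$ be any Kronecker canonical form of $A-\lambda B$, and suppose that $A-\lambda B$ has at least $k$ left minimal indices, i.e. $\ell\ge k$. Then there is a generic set $\Omega\subseteq\mathbb C^{n\times k}$ such that for every $U\in\Omega$ there exist nonsingular matrices $P\in\mathbb C^{n\times n}$ and $Q\in\mathbb C^{m\times m}$ with $$P(A-\lambda B)Q=\begin{bmatrix}R(\lambda)&0\\0&S(\lambda)\end{bmatrix}\qquad\text{and}\qquad PU=\begin{bmatrix}0\\ \widetilde U\end{bmatrix},$$ where $PU$ is partitioned conformably with the rows of $P(A-\lambda B)Q$, i.e. the zero block consists of the rows of $R(\lambda)$. -/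

import Mathlib

open Matrix

/-- The upper bidiagonal Jordan block of size `s` with eigenvalue `μ`. -/
def jordanBlock (μ : ℂ) (s : ℕ) : Matrix (Fin s) (Fin s) ℂ :=
  Matrix.of fun i j => if j = i then μ else if j.val = i.val + 1 then 1 else 0

/-- The `j × (j+1)` matrix `[0 I_j]`, the constant part of `L_j(λ) = [0 I_j] - λ [I_j 0]`. -/
def kroneckerConst (j : ℕ) : Matrix (Fin j) (Fin (j + 1)) ℂ :=
  Matrix.of fun a b => if b = a.succ then 1 else 0

/-- The `j × (j+1)` matrix `[I_j 0]`, the leading part of `L_j(λ) = [0 I_j] - λ [I_j 0]`. -/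
def kroneckerLead (j : ℕ) : Matrix (Fin j) (Fin (j + 1)) ℂ :=
  Matrix.of fun a b => if b = a.castSucc then 1 else 0

/-- The parameters of a Kronecker canonical form
`diag(R(λ), S(λ))`, where `R(λ) = diag(J - λ I, I - λ N)` and
`S(λ) = diag(L_{m_1}(λ), …, L_{m_p}(λ), L_{n_1}(λ)ᵀ, …, L_{n_ℓ}(λ)ᵀ)`: the eigenvalues and (positive)
sizes of the Jordan blocks of `J`, the (positive) sizes of the Jordan blocks of the nilpotent
matrix `N`, the right minimal indices `m_i ≥ 0` and the left minimal indices `n_i ≥ 0`. -/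
structure KroneckerForm where
  numFin : ℕ
  eigenvalue : Fin numFin → ℂ
  finSize : Fin numFin → ℕ
  finSize_pos : ∀ i, 0 < finSize i
  numInf : ℕ
  infSize : Fin numInf → ℕ
  infSize_pos : ∀ i, 0 < infSize i
  numRight : ℕ
  right : Fin numRight → ℕ
  numLeft : ℕ
  left : Fin numLeft → ℕ

namespace KroneckerForm

/-- Block positions (block number, position in the block) of the rows, and of the columns, of the
regular part. -/
abbrev Reg (K : KroneckerForm) : Type :=
  (Σ i : Fin K.numFin, Fin (K.finSize i)) ⊕ (Σ i : Fin K.numInf, Fin (K.infSize i))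

/-- Block positions of the rows of the singular part. -/
abbrev SingRow (K : KroneckerForm) : Type :=
  (Σ i : Fin K.numRight, Fin (K.right i)) ⊕ (Σ i : Fin K.numLeft, Fin (K.left i + 1))

/-- Block positions of the columns of the singular part. -/
abbrev SingCol (K : KroneckerForm) : Type :=
  (Σ i : Fin K.numRight, Fin (K.right i + 1)) ⊕ (Σ i : Fin K.numLeft, Fin (K.left i))

/-- The number of rows, and of columns, of the regular part. -/
def regSize (K : KroneckerForm) : ℕ := (∑ i, K.finSize i) + ∑ i, K.infSize i

/-- The number of rows of the singular part. -/
def singRows (K : KroneckerForm) : ℕ := (∑ i, K.right i) + ∑ i, (K.left i + 1)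

/-- The number of columns of the singular part. -/
def singCols (K : KroneckerForm) : ℕ := (∑ i, (K.right i + 1)) + ∑ i, K.left i

/-- The numbering of the rows of `diag(R, S)` from top to bottom. -/
def rowEquiv (K : KroneckerForm) : K.Reg ⊕ K.SingRow ≃ Fin (K.regSize + K.singRows) :=
  (Equiv.sumCongr ((Equiv.sumCongr finSigmaFinEquiv finSigmaFinEquiv).trans finSumFinEquiv)
    ((Equiv.sumCongr finSigmaFinEquiv finSigmaFinEquiv).trans finSumFinEquiv)).trans finSumFinEquiv

/-- The numbering of the columns of `diag(R, S)` from left to right. -/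
def colEquiv (K : KroneckerForm) : K.Reg ⊕ K.SingCol ≃ Fin (K.regSize + K.singCols) :=
  (Equiv.sumCongr ((Equiv.sumCongr finSigmaFinEquiv finSigmaFinEquiv).trans finSumFinEquiv)
    ((Equiv.sumCongr finSigmaFinEquiv finSigmaFinEquiv).trans finSumFinEquiv)).trans finSumFinEquiv

/-- The constant coefficient `diag(J, I)` of the regular part `R(λ) = diag(J - λ I, I - λ N)`. -/
def regConst (K : KroneckerForm) : Matrix K.Reg K.Reg ℂ :=
  Matrix.fromBlocks (Matrix.blockDiagonal' fun i => jordanBlock (K.eigenvalue i) (K.finSize i)) 0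
    0 1

/-- The matrix `diag(I, N)` of the regular part `R(λ) = diag(J, I) - λ diag(I, N)`. -/
def regLead (K : KroneckerForm) : Matrix K.Reg K.Reg ℂ :=
  Matrix.fromBlocks 1 0 0 (Matrix.blockDiagonal' fun i => jordanBlock 0 (K.infSize i))

/-- The matrix `S₀` of the singular part `S(λ) = S₀ - λ S₁`. -/
def singConst (K : KroneckerForm) : Matrix K.SingRow K.SingCol ℂ :=
  Matrix.fromBlocks (Matrix.blockDiagonal' fun i => kroneckerConst (K.right i)) 0
    0 (Matrix.blockDiagonal' fun i => (kroneckerConst (K.left i))ᵀ)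

/-- The matrix `S₁` of the singular part `S(λ) = S₀ - λ S₁`. -/
def singLead (K : KroneckerForm) : Matrix K.SingRow K.SingCol ℂ :=
  Matrix.fromBlocks (Matrix.blockDiagonal' fun i => kroneckerLead (K.right i)) 0
    0 (Matrix.blockDiagonal' fun i => (kroneckerLead (K.left i))ᵀ)

/-- The matrix `A₀` of the canonical form `diag(R(λ), S(λ)) = A₀ - λ B₀`. -/
def const (K : KroneckerForm) :
    Matrix (Fin (K.regSize + K.singRows)) (Fin (K.regSize + K.singCols)) ℂ :=
  Matrix.reindex K.rowEquiv K.colEquiv (Matrix.fromBlocks K.regConst 0 0 K.singConst)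

/-- The matrix `B₀` of the canonical form `diag(R(λ), S(λ)) = A₀ - λ B₀`. -/
def lead (K : KroneckerForm) :
    Matrix (Fin (K.regSize + K.singRows)) (Fin (K.regSize + K.singCols)) ℂ :=
  Matrix.reindex K.rowEquiv K.colEquiv (Matrix.fromBlocks K.regLead 0 0 K.singLead)

/-- `P` and `Q` are nonsingular and `P (A - λ B) Q` is the canonical form with parameters `K`
(two pencils are equal when both their coefficients are). -/
def IsBroughtBy (K : KroneckerForm) {n m : ℕ} (A B : Matrix (Fin n) (Fin m) ℂ)
    (P : Matrix (Fin n) (Fin n) ℂ) (Q : Matrix (Fin m) (Fin m) ℂ) : Prop :=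
  P.det ≠ 0 ∧ Q.det ≠ 0 ∧
    ∃ (hn : n = K.regSize + K.singRows) (hm : m = K.regSize + K.singCols),
      P * A * Q = K.const.submatrix (Fin.cast hn) (Fin.cast hm) ∧
      P * B * Q = K.lead.submatrix (Fin.cast hn) (Fin.cast hm)

/-- `K` is a Kronecker canonical form of the pencil `A - λ B`. -/
def IsFormOf (K : KroneckerForm) {n m : ℕ} (A B : Matrix (Fin n) (Fin m) ℂ) : Prop :=
  ∃ P Q, K.IsBroughtBy A B P Q

end KroneckerForm

/-- A subset of `ℂ^σ` is algebraic if it is the set of common zeros of finitely many polynomials. -/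
def IsAlgebraicSet {σ : Type*} (Z : Set (σ → ℂ)) : Prop :=
  ∃ F : Finset (MvPolynomial σ ℂ), Z = {x | ∀ p ∈ F, MvPolynomial.eval x p = 0}

/-- A subset of `ℂ^σ` is generic if its complement lies in a proper algebraic set. -/
def IsGenericSet {σ : Type*} (Ω : Set (σ → ℂ)) : Prop :=
  ∃ Z : Set (σ → ℂ), IsAlgebraicSet Z ∧ Z ≠ Set.univ ∧ Ωᶜ ⊆ Z

/-- A set of `n × k` matrices is generic if it is so as a subset of `ℂ^{nk}`. -/
def IsGenericMatrixSet {n k : ℕ} (Ω : Set (Matrix (Fin n) (Fin k) ℂ)) : Prop :=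
  IsGenericSet {x : Fin n × Fin k → ℂ | Matrix.of (fun i j => x (i, j)) ∈ Ω}

/-! Existence of a canonical form goes by induction on the number of rows plus columns, one block
being split off at a time. A direct summand is the same as a retract: a pair of pencil morphisms
into `A - λ B` and a pair back whose composites are the identity (`PencilSplits.of_retract`). Up to
transposition, an exchange of the coefficients or a shift by an eigenvalue, the constant coefficient
kills a nonzero vector `v₀`. Chains `A v_{i+1} = B v_i` starting there either can be closed by `B
v_s = 0` or have bounded length. By duality, a step beyond which the chain cannot go (or before
which it cannot close) yields functionals with `ψ_{i+1} B = ψ_i A` and `ψ₀(B v₀) ≠ 0`. They pair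
with the chain through a triangular matrix with nonzero diagonal, which makes the chain a retract: a
block `L_s` or a Jordan block (`PencilChain.splits_of_ker`).

The generic statement rests on the freedom left in `P` and `Q`. Suppose `P₀`, `Q₀` give the form
`diag(R, S)`, and constant matrices `X`, `Y` satisfy `R(λ) Y + X S(λ) = 0`. Then `[I X; 0 I] P₀` and
`Q₀ [I Y; 0 I]` give the same form. If `P₀ U` has blocks `U₁`, `U₂`, it remains to achieve `U₁ + X
U₂ = 0`. Write `R = C - λ D`; since `C = diag(J, I)` and `D = diag(I, N)` commute, each left minimal
index `n_i` and each vector `z_i` give a solution in which `X` has the columns `C^a D^(n_i - a) z_i`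
(`exists_coupling`). Using `k` such blocks, `U₁ + X U₂ = 0` is a square linear system for the `z_i`,
and the determinant of `couplingMatrix` is a polynomial in `U`. It is not identically zero: binomial
entries turn the matrix into a block diagonal one with blocks `(μ D - C)^(n_i)`, invertible when `μ`
is not an eigenvalue of `J`. -/

/-! ### Strict equivalence of pencils -/

/-- The pencils `A - λ B` and `A' - λ B'` are strictly equivalent; the index types of the two
pencils may differ, so that the transforming matrices come with their two-sided inverses. -/
def PencilEquiv {m n m' n' : Type*} [Fintype m] [Fintype n] [Fintype m'] [Fintype n']
    [DecidableEq m] [DecidableEq n] [DecidableEq m'] [DecidableEq n']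
    (A B : Matrix m n ℂ) (A' B' : Matrix m' n' ℂ) : Prop :=
  ∃ (P : Matrix m' m ℂ) (P' : Matrix m m' ℂ) (Q : Matrix n n' ℂ) (Q' : Matrix n' n ℂ),
    P * P' = 1 ∧ P' * P = 1 ∧ Q * Q' = 1 ∧ Q' * Q = 1 ∧ P * A * Q = A' ∧ P * B * Q = B'

namespace PencilEquiv

section

variable {m n m' n' m'' n'' : Type*} [Fintype m] [Fintype n] [Fintype m'] [Fintype n']
  [Fintype m''] [Fintype n''] [DecidableEq m] [DecidableEq n] [DecidableEq m'] [DecidableEq n']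
  [DecidableEq m''] [DecidableEq n'']

theorem trans {A B : Matrix m n ℂ} {A' B' : Matrix m' n' ℂ} {A'' B'' : Matrix m'' n'' ℂ}
    (h : PencilEquiv A B A' B') (h' : PencilEquiv A' B' A'' B'') : PencilEquiv A B A'' B'' := by
  obtain ⟨P, P', Q, Q', h1, h2, h3, h4, rfl, rfl⟩ := h
  obtain ⟨R, R', S, S', g1, g2, g3, g4, rfl, rfl⟩ := h'
  refine ⟨R * P, P' * R', Q * S, S' * Q', ?_, ?_, ?_, ?_, ?_, ?_⟩
  · rw [Matrix.mul_assoc, ← Matrix.mul_assoc P, h1, Matrix.one_mul, g1]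
  · rw [Matrix.mul_assoc, ← Matrix.mul_assoc R', g2, Matrix.one_mul, h2]
  · rw [Matrix.mul_assoc, ← Matrix.mul_assoc S, g3, Matrix.one_mul, h3]
  · rw [Matrix.mul_assoc, ← Matrix.mul_assoc Q', h4, Matrix.one_mul, g4]
  · simp only [Matrix.mul_assoc]
  · simp only [Matrix.mul_assoc]

theorem symm {A B : Matrix m n ℂ} {A' B' : Matrix m' n' ℂ} (h : PencilEquiv A B A' B') :
    PencilEquiv A' B' A B := by
  obtain ⟨P, P', Q, Q', h1, h2, h3, h4, rfl, rfl⟩ := h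
  have key : ∀ X : Matrix m n ℂ, P' * (P * X * Q) * Q' = X := fun X => by
    rw [Matrix.mul_assoc P X, ← Matrix.mul_assoc P' P, h2, Matrix.one_mul, Matrix.mul_assoc X, h3,
      Matrix.mul_one]
  exact ⟨P', P, Q', Q, h2, h1, h4, h3, key A, key B⟩

theorem transpose {A B : Matrix m n ℂ} {A' B' : Matrix m' n' ℂ} (h : PencilEquiv A B A' B') :
    PencilEquiv Aᵀ Bᵀ A'ᵀ B'ᵀ := by
  obtain ⟨P, P', Q, Q', h1, h2, h3, h4, rfl, rfl⟩ := h
  refine ⟨Qᵀ, Q'ᵀ, Pᵀ, P'ᵀ, ?_, ?_, ?_, ?_, ?_, ?_⟩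
  all_goals simp only [← Matrix.transpose_mul, h1, h2, h3, h4, Matrix.transpose_one,
    Matrix.mul_assoc]

theorem swap {A B : Matrix m n ℂ} {A' B' : Matrix m' n' ℂ} (h : PencilEquiv A B A' B') :
    PencilEquiv B A B' A' := by
  obtain ⟨P, P', Q, Q', h1, h2, h3, h4, h5, h6⟩ := h
  exact ⟨P, P', Q, Q', h1, h2, h3, h4, h6, h5⟩

theorem add_smul {A B : Matrix m n ℂ} {A' B' : Matrix m' n' ℂ} (h : PencilEquiv A B A' B')
    (ρ : ℂ) : PencilEquiv (A + ρ • B) B (A' + ρ • B') B' := by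
  obtain ⟨P, P', Q, Q', h1, h2, h3, h4, rfl, rfl⟩ := h
  refine ⟨P, P', Q, Q', h1, h2, h3, h4, ?_, rfl⟩
  simp [Matrix.mul_add, Matrix.add_mul]

theorem submatrix (A B : Matrix m n ℂ) (e : m' ≃ m) (f : n' ≃ n) :
    PencilEquiv A B (A.submatrix e f) (B.submatrix e f) := by
  have key : ∀ C : Matrix m n ℂ, (1 : Matrix m m ℂ).submatrix e id * C *
      (1 : Matrix n n ℂ).submatrix id f = C.submatrix e f := by
    intro C
    ext i j
    simp [Matrix.mul_apply, Matrix.one_apply]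
  refine ⟨(1 : Matrix m m ℂ).submatrix e id, (1 : Matrix m m ℂ).submatrix id e,
    (1 : Matrix n n ℂ).submatrix id f, (1 : Matrix n n ℂ).submatrix f id, ?_, ?_, ?_, ?_,
    key A, key B⟩
  · rw [← Matrix.submatrix_mul _ _ _ _ _ Function.bijective_id]; simp
  · rw [← Matrix.submatrix_mul _ _ _ _ _ e.bijective]; simp
  · rw [← Matrix.submatrix_mul _ _ _ _ _ f.bijective]; simp
  · rw [← Matrix.submatrix_mul _ _ _ _ _ Function.bijective_id]; simp

theorem card_eq {A B : Matrix m n ℂ} {A' B' : Matrix m' n' ℂ} (h : PencilEquiv A B A' B') :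
    Fintype.card m = Fintype.card m' ∧ Fintype.card n = Fintype.card n' := by
  obtain ⟨P, P', Q, Q', h1, h2, h3, h4, -, -⟩ := h
  exact ⟨(Matrix.square_of_invertible P P' h1 h2).symm, Matrix.square_of_invertible Q Q' h3 h4⟩

end

theorem fromBlocks {m n m' n' p q p' q' : Type*} [Fintype m] [Fintype n] [Fintype m'] [Fintype n']
    [Fintype p] [Fintype q] [Fintype p'] [Fintype q']
    [DecidableEq m] [DecidableEq n] [DecidableEq m'] [DecidableEq n']
    [DecidableEq p] [DecidableEq q] [DecidableEq p'] [DecidableEq q']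
    {A B : Matrix m n ℂ} {A' B' : Matrix m' n' ℂ} {C D : Matrix p q ℂ} {C' D' : Matrix p' q' ℂ}
    (h : PencilEquiv A B A' B') (h' : PencilEquiv C D C' D') :
    PencilEquiv (fromBlocks A 0 0 C) (fromBlocks B 0 0 D)
      (fromBlocks A' 0 0 C') (fromBlocks B' 0 0 D') := by
  obtain ⟨P, P', Q, Q', h1, h2, h3, h4, rfl, rfl⟩ := h
  obtain ⟨R, R', S, S', g1, g2, g3, g4, rfl, rfl⟩ := h'
  refine ⟨Matrix.fromBlocks P 0 0 R, Matrix.fromBlocks P' 0 0 R', Matrix.fromBlocks Q 0 0 S,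
    Matrix.fromBlocks Q' 0 0 S', ?_, ?_, ?_, ?_, ?_, ?_⟩ <;>
  simp [Matrix.fromBlocks_multiply, *]

end PencilEquiv

/-! ### Direct summands as retracts -/

/-- A matrix with a left inverse is completed to an invertible one. -/
theorem exists_complement_of_mul_eq_one {n c : Type*} [Fintype n] [Fintype c] [DecidableEq n]
    [DecidableEq c] (G : Matrix c n ℂ) (E : Matrix n c ℂ) (h : G * E = 1) :
    ∃ (d : ℕ) (K : Matrix n (Fin d) ℂ) (L : Matrix (Fin d) n ℂ),
      L * K = 1 ∧ L * E = 0 ∧ G * K = 0 ∧ E * G + K * L = 1 := by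
  set S := LinearMap.ker (Matrix.toLin' G) with hS
  let b := Module.finBasis ℂ S
  have hmem : ∀ x, (1 - E * G) *ᵥ x ∈ S := by
    intro x
    rw [hS, LinearMap.mem_ker, Matrix.toLin'_apply, Matrix.mulVec_mulVec, Matrix.mul_sub,
      Matrix.mul_one, ← Matrix.mul_assoc, h, Matrix.one_mul, sub_self, Matrix.zero_mulVec]
  let p : (n → ℂ) →ₗ[ℂ] S := (Matrix.toLin' (1 - E * G)).codRestrict S hmem
  -- `1 - E G` is the projection onto `ker G` along the range of `E`; `K` holds a basis of `ker G`,
  -- and `L` the coordinates of this projection.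
  let K := LinearMap.toMatrix b (Pi.basisFun ℂ n) S.subtype
  let L := LinearMap.toMatrix (Pi.basisFun ℂ n) b p
  have hG : LinearMap.toMatrix (Pi.basisFun ℂ n) (Pi.basisFun ℂ c) (Matrix.toLin' G) = G :=
    LinearMap.toMatrix'_toLin' G
  have hE : LinearMap.toMatrix (Pi.basisFun ℂ c) (Pi.basisFun ℂ n) (Matrix.toLin' E) = E :=
    LinearMap.toMatrix'_toLin' E
  have hKL : K * L = 1 - E * G := by
    rw [← LinearMap.toMatrix_comp]
    have : S.subtype ∘ₗ p = Matrix.toLin' (1 - E * G) := rfl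
    rw [this, LinearMap.toMatrix_eq_toMatrix', LinearMap.toMatrix'_toLin']
  refine ⟨_, K, L, ?_, ?_, ?_, ?_⟩
  · rw [← LinearMap.toMatrix_comp]
    have : p ∘ₗ S.subtype = LinearMap.id := by
      ext x : 2
      have hx : G *ᵥ (x : n → ℂ) = 0 := x.2
      change (1 - E * G) *ᵥ (x : n → ℂ) = x
      rw [Matrix.sub_mulVec, ← Matrix.mulVec_mulVec, hx]
      simp
    rw [this, LinearMap.toMatrix_id]
  · rw [← hE, ← LinearMap.toMatrix_comp]
    have : p ∘ₗ Matrix.toLin' E = 0 := by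
      apply LinearMap.ext; intro x; ext1
      change (1 - E * G) *ᵥ (E *ᵥ x) = 0
      rw [Matrix.mulVec_mulVec, Matrix.sub_mul, Matrix.mul_assoc, h]
      simp
    rw [this, map_zero]
  · rw [← hG, ← LinearMap.toMatrix_comp]
    have : Matrix.toLin' G ∘ₗ S.subtype = 0 := by
      ext1 x; exact x.2
    rw [this, map_zero]
  · rw [hKL]; abel

/-- The pencil `A - λ B` is strictly equivalent to the direct sum of `C - λ D` and another pencil. -/
def PencilSplits {m n r c : Type*} [Fintype m] [Fintype n] [Fintype r] [Fintype c]
    [DecidableEq m] [DecidableEq n] [DecidableEq r] [DecidableEq c]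
    (A B : Matrix m n ℂ) (C D : Matrix r c ℂ) : Prop :=
  ∃ (p q : ℕ) (A' B' : Matrix (Fin p) (Fin q) ℂ),
    PencilEquiv A B (fromBlocks C 0 0 A') (fromBlocks D 0 0 B')

namespace PencilSplits

variable {m n r c : Type*} [Fintype m] [Fintype n] [Fintype r] [Fintype c]
    [DecidableEq m] [DecidableEq n] [DecidableEq r] [DecidableEq c]

theorem transpose {A B : Matrix m n ℂ} {C D : Matrix r c ℂ} (h : PencilSplits A B C D) :
    PencilSplits Aᵀ Bᵀ Cᵀ Dᵀ := by
  obtain ⟨p, q, A', B', h⟩ := h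
  refine ⟨q, p, A'ᵀ, B'ᵀ, ?_⟩
  simpa [Matrix.fromBlocks_transpose] using h.transpose

theorem swap {A B : Matrix m n ℂ} {C D : Matrix r c ℂ} (h : PencilSplits A B C D) :
    PencilSplits B A D C := by
  obtain ⟨p, q, A', B', h⟩ := h
  exact ⟨p, q, B', A', h.swap⟩

theorem add_smul {A B : Matrix m n ℂ} {C D : Matrix r c ℂ} (h : PencilSplits A B C D) (ρ : ℂ) :
    PencilSplits (A + ρ • B) B (C + ρ • D) D := by
  obtain ⟨p, q, A', B', h⟩ := h
  refine ⟨p, q, A' + ρ • B', B', ?_⟩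
  simpa [Matrix.fromBlocks_smul, Matrix.fromBlocks_add] using h.add_smul ρ

theorem congr {r' c' : Type*} [Fintype r'] [Fintype c'] [DecidableEq r'] [DecidableEq c']
    {A B : Matrix m n ℂ} {C D : Matrix r c ℂ} {C' D' : Matrix r' c' ℂ}
    (h : PencilSplits A B C D) (h' : PencilEquiv C D C' D') : PencilSplits A B C' D' := by
  obtain ⟨p, q, A', B', h⟩ := h
  refine ⟨p, q, A', B', h.trans (h'.fromBlocks ?_)⟩
  simpa using PencilEquiv.submatrix A' B' (Equiv.refl _) (Equiv.refl _)

/-- The pair `(E, F)` is a morphism of pencils from `C - λ D` to `A - λ B`, and `(G, H)` is one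
back. The kernels of `G` and `H` form a subpencil complementary to the image, so no off-diagonal
blocks appear. -/
theorem of_retract {A B : Matrix m n ℂ} {C D : Matrix r c ℂ} {E : Matrix n c ℂ}
    {F : Matrix m r ℂ} {G : Matrix c n ℂ} {H : Matrix r m ℂ} (hAE : A * E = F * C)
    (hBE : B * E = F * D) (hCG : C * G = H * A) (hDG : D * G = H * B) (hGE : G * E = 1)
    (hHF : H * F = 1) : PencilSplits A B C D := by
  obtain ⟨q, K, L, h1, h2, h3, h4⟩ := exists_complement_of_mul_eq_one G E hGE
  obtain ⟨p, K', L', g1, g2, g3, g4⟩ := exists_complement_of_mul_eq_one H F hHF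
  have key : ∀ {X : Matrix m n ℂ} {Y : Matrix r c ℂ}, X * E = F * Y → Y * G = H * X →
      fromRows H L' * X * fromCols E K = fromBlocks Y 0 0 (L' * X * K) := by
    intro X Y e1 e2
    rw [Matrix.fromRows_mul, Matrix.fromRows_mul_fromCols, ← e2, Matrix.mul_assoc Y, hGE,
      Matrix.mul_assoc L', e1, Matrix.mul_assoc Y, h3, ← Matrix.mul_assoc L', g2]
    simp
  refine ⟨p, q, L' * A * K, L' * B * K, fromRows H L', fromCols F K', fromCols E K,
    fromRows G L, ?_, ?_, ?_, ?_, key hAE hCG, key hBE hDG⟩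
  · rw [Matrix.fromRows_mul_fromCols, hHF, g1, g2, g3, Matrix.fromBlocks_one]
  · rw [Matrix.fromCols_mul_fromRows, g4]
  · rw [Matrix.fromCols_mul_fromRows, h4]
  · rw [Matrix.fromRows_mul_fromCols, hGE, h1, h2, h3, Matrix.fromBlocks_one]

/-- The composite `(G E, H F)` is an automorphism of `C - λ D`, so its inverse is again a morphism
and can be absorbed into `(G, H)`. -/
theorem of_isUnit_det {A B : Matrix m n ℂ} {C D : Matrix r c ℂ} {E : Matrix n c ℂ}
    {F : Matrix m r ℂ} {G : Matrix c n ℂ} {H : Matrix r m ℂ} (hAE : A * E = F * C)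
    (hBE : B * E = F * D) (hCG : C * G = H * A) (hDG : D * G = H * B) (hGE : IsUnit (G * E).det)
    (hHF : IsUnit (H * F).det) : PencilSplits A B C D := by
  have key : ∀ {X : Matrix m n ℂ} {Y : Matrix r c ℂ}, X * E = F * Y → Y * G = H * X →
      Y * ((G * E)⁻¹ * G) = (H * F)⁻¹ * H * X := by
    intro X Y e1 e2
    have h1 : Y * (G * E) = H * F * Y := by
      rw [← Matrix.mul_assoc, e2, Matrix.mul_assoc, e1, Matrix.mul_assoc]
    have h2 : (H * F)⁻¹ * Y = Y * (G * E)⁻¹ := by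
      calc (H * F)⁻¹ * Y = (H * F)⁻¹ * (Y * (G * E)) * (G * E)⁻¹ := by
            rw [← Matrix.mul_assoc, Matrix.mul_nonsing_inv_cancel_right _ _ hGE]
        _ = Y * (G * E)⁻¹ := by
            rw [h1, ← Matrix.mul_assoc ((H * F)⁻¹), Matrix.nonsing_inv_mul _ hHF, Matrix.one_mul]
    rw [← Matrix.mul_assoc, ← h2, Matrix.mul_assoc, e2, Matrix.mul_assoc]
  refine of_retract (G := (G * E)⁻¹ * G) (H := (H * F)⁻¹ * H) hAE hBE (key hAE hCG) (key hBE hDG)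
    ?_ ?_
  · rw [Matrix.mul_assoc, Matrix.nonsing_inv_mul _ hGE]
  · rw [Matrix.mul_assoc, Matrix.nonsing_inv_mul _ hHF]

end PencilSplits

/-! ### Chains of vectors and dual chains of functionals -/

namespace PencilChain

section LinearMaps

variable {V W : Type*} [AddCommGroup V] [Module ℂ V] [AddCommGroup W] [Module ℂ W]

/-- The `k`-th iterate of the map `R ↦ A (B⁻¹ R)` on subspaces, applied to `S`. -/
def iter (A B : V →ₗ[ℂ] W) (S : Submodule ℂ W) : ℕ → Submodule ℂ W
  | 0 => S
  | k + 1 => ((iter A B S k).comap B).map A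

theorem mem_iter_succ {A B : V →ₗ[ℂ] W} {S : Submodule ℂ W} {k : ℕ} {w : W} :
    w ∈ iter A B S (k + 1) ↔ ∃ v, B v ∈ iter A B S k ∧ A v = w := by
  simp [iter]

theorem exists_chain {A B : V →ₗ[ℂ] W} {S : Submodule ℂ W} (k : ℕ) {v₀ : V}
    (h : B v₀ ∈ iter A B S k) :
    ∃ v : ℕ → V, v 0 = v₀ ∧ (∀ i < k, A (v (i + 1)) = B (v i)) ∧ B (v k) ∈ S := by
  induction k generalizing v₀ with
  | zero => exact ⟨fun _ => v₀, rfl, by simp, h⟩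
  | succ k ih =>
    obtain ⟨v₁, h1, h2⟩ := mem_iter_succ.1 h
    obtain ⟨v, hv0, hv, hvk⟩ := ih h1
    refine ⟨fun i => Nat.casesOn i v₀ v, rfl, ?_, hvk⟩
    rintro (_ | i) hi
    · simpa [hv0] using h2
    · exact hv i (by omega)

/-- Since `θ` vanishes on `B⁻¹ R`, it factors through the map from `V` to `W / R` induced by `B`. -/
theorem exists_extension (B : V →ₗ[ℂ] W) (R : Submodule ℂ W) (θ : V →ₗ[ℂ] ℂ)
    (h : ∀ x, B x ∈ R → θ x = 0) :
    ∃ ψ : W →ₗ[ℂ] ℂ, (∀ w ∈ R, ψ w = 0) ∧ ∀ x, ψ (B x) = θ x := by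
  have hker : LinearMap.ker (R.mkQ ∘ₗ B) ≤ LinearMap.ker θ := by
    intro x hx
    exact h x (by simpa using hx)
  obtain ⟨φ, hφ⟩ := (LinearMap.range_dualMap_eq_dualAnnihilator_ker (R.mkQ ∘ₗ B)).ge
    (show θ ∈ _ from (Submodule.mem_dualAnnihilator θ).2 fun x hx => hker hx)
  refine ⟨φ ∘ₗ R.mkQ, fun w hw => ?_, fun x => ?_⟩
  · have : R.mkQ w = 0 := by simpa using hw
    simp only [LinearMap.comp_apply, this, map_zero]
  · exact LinearMap.congr_fun hφ x

/-- If `ψ` kills `A (B⁻¹ R)`, then `ψ ∘ A` kills `B⁻¹ R` and so has the form `ψ' ∘ B` with `ψ'`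
killing `R`. Each such step undoes one iteration. -/
theorem exists_dual_chain {A B : V →ₗ[ℂ] W} {S : Submodule ℂ W} (k : ℕ) {ψ₀ : W →ₗ[ℂ] ℂ}
    (h : ∀ w ∈ iter A B S k, ψ₀ w = 0) :
    ∃ ψ : ℕ → W →ₗ[ℂ] ℂ, ψ 0 = ψ₀ ∧ (∀ i < k, ∀ x, ψ (i + 1) (B x) = ψ i (A x)) ∧
      ∀ w ∈ S, ψ k w = 0 := by
  induction k generalizing ψ₀ with
  | zero => exact ⟨fun _ => ψ₀, rfl, by simp, h⟩
  | succ k ih =>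
    obtain ⟨ψ₁, h1, h2⟩ := exists_extension B (iter A B S k) (ψ₀ ∘ₗ A) fun x hx =>
      h _ (mem_iter_succ.2 ⟨x, hx, rfl⟩)
    obtain ⟨ψ, hψ0, hψ, hψk⟩ := ih h1
    refine ⟨fun i => Nat.casesOn i ψ₀ ψ, rfl, ?_, hψk⟩
    rintro (_ | i) hi
    · simpa [hψ0] using h2
    · exact hψ i (by omega)

theorem exists_dual_chain_of_notMem {A B : V →ₗ[ℂ] W} {S : Submodule ℂ W} (k : ℕ) {w : W}
    (h : w ∉ iter A B S k) :
    ∃ ψ : ℕ → W →ₗ[ℂ] ℂ, ψ 0 w ≠ 0 ∧ (∀ i < k, ∀ x, ψ (i + 1) (B x) = ψ i (A x)) ∧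
      ∀ w ∈ S, ψ k w = 0 := by
  obtain ⟨ψ₀, h1, h2⟩ := Submodule.exists_le_ker_of_notMem h
  obtain ⟨ψ, rfl, h3⟩ := exists_dual_chain k (ψ₀ := ψ₀) fun w hw => h2 hw
  exact ⟨ψ, h1, h3⟩

/-- A chain that is longer than the dimension allows yields a singular chain. -/
theorem exists_mem_iter_bot [FiniteDimensional ℂ V] {A B : V →ₗ[ℂ] W} {v₀ : V} (hv₀ : v₀ ≠ 0)
    (hA : A v₀ = 0) (h : ∀ k, B v₀ ∈ iter A B ⊤ k) : ∃ k, B v₀ ∈ iter A B ⊥ k := by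
  set n := Module.finrank ℂ V
  obtain ⟨v, rfl, hv, -⟩ := exists_chain n (h n)
  have hdep : ¬ LinearIndependent ℂ fun i : Fin (n + 1) => v i := by
    intro hli
    have := hli.fintype_card_le_finrank
    simp [n] at this
  obtain ⟨g, hg, i₀, hi₀⟩ := Fintype.not_linearIndependent_iff.1 hdep
  -- A linear dependence is truncated at its last nonzero coefficient `c d`.
  have hex : ∀ N ≤ n, ∀ c : ℕ → ℂ, ∑ a ∈ Finset.range (N + 1), c a • v a = 0 →
      (∃ i ≤ N, c i ≠ 0) →
      ∃ d ≤ n, c d ≠ 0 ∧ ∑ a ∈ Finset.range (d + 1), c a • v a = 0 := by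
    intro N
    induction N with
    | zero =>
      rintro hN c h1 ⟨i, hi, hc⟩
      obtain rfl : i = 0 := by omega
      exact ⟨0, hN, hc, h1⟩
    | succ N ih =>
      rintro hN c h1 ⟨i, hi, hc⟩
      by_cases h0 : c (N + 1) = 0
      · rw [Finset.sum_range_succ, h0, zero_smul, add_zero] at h1
        refine ih (by omega) c h1 ⟨i, ?_, hc⟩
        by_contra hiN
        obtain rfl : i = N + 1 := by omega
        exact hc h0
      · exact ⟨N + 1, hN, h0, h1⟩
  obtain ⟨c, hc⟩ : ∃ c : ℕ → ℂ, ∀ i : Fin (n + 1), c i = g i :=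
    ⟨fun a => if ha : a < n + 1 then g ⟨a, ha⟩ else 0, fun i => dif_pos i.2⟩
  obtain ⟨d, hd, hcd, hsum⟩ := hex n le_rfl c
    (by rw [Finset.sum_range]; simpa only [hc] using hg) ⟨i₀, by omega, by rwa [hc]⟩
  -- Shifting the coefficients of the dependence gives a chain run backwards: `A u_j = B u_{j+1}`
  -- because `A v_0 = 0`. It starts at `u_0 = 0`, the dependence itself, and ends at `u_d = c_d
  -- v_0`. Hence `B v_0` is reached from zero in `d - 1` steps; `d = 0` would force `v_0 = 0`.
  let u : ℕ → V := fun j => ∑ a ∈ Finset.range (d + 1 - j), c (a + j) • v a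
  have hu : ∀ j ≤ d, A (u j) = B (u (j + 1)) := by
    intro j hj
    simp only [u]
    rw [show d + 1 - j = (d - j) + 1 by omega, Finset.sum_range_succ', zero_add, map_add,
      map_smul, hA, smul_zero, add_zero, map_sum, map_sum, show d + 1 - (j + 1) = d - j by omega]
    refine Finset.sum_congr rfl fun a ha => ?_
    rw [map_smul, map_smul, hv a (by have := Finset.mem_range.1 ha; omega),
      show a + 1 + j = a + (j + 1) by omega]
  have hu0 : u 0 = 0 := hsum
  have hud : u d = c d • v 0 := by simp [u]
  have hmem : ∀ j < d, B (u (j + 1)) ∈ iter A B ⊥ j := by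
    intro j
    induction j with
    | zero =>
      intro _
      rw [← hu 0 (by omega), hu0, map_zero]
      exact Submodule.zero_mem _
    | succ j ih =>
      intro hj
      rw [← hu (j + 1) (by omega)]
      exact mem_iter_succ.2 ⟨_, ih (by omega), rfl⟩
  cases d with
  | zero => exact absurd (hud.symm.trans hu0) (smul_ne_zero hcd hv₀)
  | succ d =>
    refine ⟨d, ?_⟩
    have := hmem d (by omega)
    rw [hud, map_smul] at this
    exact (Submodule.smul_mem_iff _ hcd).1 this

end LinearMaps

/-! ### Splitting off one block -/

section Matrices

variable {m n : Type*} [Fintype m] [Fintype n] [DecidableEq m] [DecidableEq n]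

omit [Fintype m] [DecidableEq m] [DecidableEq n] in
/-- Common part of the splittings: a chain of vectors and a dual chain of functionals, paired
by an upper triangular matrix. -/
theorem pairing {A B : Matrix m n ℂ} {s t : ℕ} {v : ℕ → n → ℂ} {ψ : ℕ → (m → ℂ) →ₗ[ℂ] ℂ}
    (hv0 : A *ᵥ v 0 = 0) (hv : ∀ i < s, A *ᵥ v (i + 1) = B *ᵥ v i)
    (hψ0 : ψ 0 (B *ᵥ v 0) ≠ 0)
    (hψ : ∀ i < t, ∀ x, ψ (i + 1) (B *ᵥ x) = ψ i (A *ᵥ x)) :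
    (∀ i ≤ t, ∀ j ≤ s, j < i → ψ i (B *ᵥ v j) = 0) ∧
      ∀ i ≤ t, i ≤ s → ψ i (B *ᵥ v i) ≠ 0 := by
  constructor
  · intro i hi j
    induction j generalizing i with
    | zero =>
      intro _ hij
      obtain ⟨i, rfl⟩ := Nat.exists_eq_add_of_lt hij
      rw [hψ _ (by omega), hv0, map_zero]
    | succ j ih =>
      intro hj hij
      cases i with
      | zero => omega
      | succ i => rw [hψ i (by omega), hv j (by omega)]; exact ih i (by omega) (by omega) (by omega)
  · intro i
    induction i with
    | zero => intro _ _; exact hψ0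
    | succ i ih =>
      intro h1 h2
      rw [hψ i (by omega), hv i (by omega)]
      exact ih (by omega) (by omega)

/-- The matrix of a family of functionals. -/
def rowsOf {r : Type*} (ψ : r → (m → ℂ) →ₗ[ℂ] ℂ) : Matrix r m ℂ :=
  Matrix.of fun a i => ψ a (Pi.single i 1)

theorem rowsOf_mulVec {r : Type*} (ψ : r → (m → ℂ) →ₗ[ℂ] ℂ) (w : m → ℂ) (a : r) :
    (rowsOf ψ *ᵥ w) a = ψ a w := by
  rw [LinearMap.pi_apply_eq_sum_univ (ψ a) w]
  simp only [Matrix.mulVec, dotProduct, rowsOf, Matrix.of_apply, smul_eq_mul]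
  refine Finset.sum_congr rfl fun i _ => ?_
  rw [mul_comm]
  congr 2
  ext j
  simp [Pi.single_apply, eq_comm]

theorem rowsOf_mul {r c : Type*} (ψ : r → (m → ℂ) →ₗ[ℂ] ℂ) (X : Matrix m c ℂ) (a : r) (b : c) :
    (rowsOf ψ * X) a b = ψ a (fun i => X i b) :=
  rowsOf_mulVec ψ (fun i => X i b) a

omit [DecidableEq n] in
theorem mul_colsOf {k c : Type*} (X : Matrix k n ℂ) (v : c → n → ℂ) (i : k) (b : c) :
    (X * Matrix.of fun x b => v b x) i b = (X *ᵥ v b) i := rfl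

theorem isUnit_det_of_pairing {s : ℕ} {T : Matrix (Fin s) (Fin s) ℂ}
    (h : ∀ i j, j < i → T i j = 0) (h' : ∀ i, T i i ≠ 0) : IsUnit T.det := by
  rw [Matrix.det_of_isUpperTriangular fun i j hij => h i j hij, isUnit_iff_ne_zero]
  exact Finset.prod_ne_zero_iff.2 fun i _ => h' i

/-- The chain spans the image of the block, and the dual chain gives the morphism back. The
condition `ψ (s + 1) = 0` supplies the last row of `J G = H A`, just as `A v₀ = 0` supplies the
first column of `A E = B E J`. Both composites equal the triangular pairing matrix `ψ_i(B v_j)`. -/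
theorem splits_jordanBlock {A B : Matrix m n ℂ} {s : ℕ} {v : ℕ → n → ℂ}
    {ψ : ℕ → (m → ℂ) →ₗ[ℂ] ℂ}
    (hv0 : A *ᵥ v 0 = 0) (hv : ∀ i < s, A *ᵥ v (i + 1) = B *ᵥ v i)
    (hψ0 : ψ 0 (B *ᵥ v 0) ≠ 0)
    (hψ : ∀ i < s + 1, ∀ x, ψ (i + 1) (B *ᵥ x) = ψ i (A *ᵥ x)) (hψs : ψ (s + 1) = 0) :
    PencilSplits A B (jordanBlock 0 (s + 1)) 1 := by
  obtain ⟨h1, h2⟩ := pairing hv0 hv hψ0 hψ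
  let E : Matrix n (Fin (s + 1)) ℂ := Matrix.of fun x b => v b x
  let H : Matrix (Fin (s + 1)) m ℂ := rowsOf fun a : Fin (s + 1) => ψ a
  have hHB : ∀ i j, (H * (B * E)) i j = ψ i (B *ᵥ v j) := fun i j => rowsOf_mul _ _ _ _
  have hdet : IsUnit (H * (B * E)).det := isUnit_det_of_pairing
    (fun i j hij => by rw [hHB]; exact h1 i (by omega) j (by omega) hij)
    (fun i => by rw [hHB]; exact h2 i (by omega) (by omega))
  refine PencilSplits.of_isUnit_det (E := E) (F := B * E) (G := H * B) (H := H) ?_ ?_ ?_ ?_ ?_ ?_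
  · ext x b
    rw [mul_colsOf, Matrix.mul_apply]
    simp only [jordanBlock, Matrix.of_apply]
    cases b using Fin.cases with
    | zero => rw [Fin.val_zero, hv0]; simp
    | succ b =>
      rw [Fin.val_succ, hv b (by omega), Finset.sum_eq_single b.castSucc]
      · simp [Fin.ext_iff, E, mul_colsOf]
      · intro c _ hc
        have : (b : ℕ) ≠ c := fun h => hc (Fin.ext h.symm)
        simp [this]
      · simp
  · simp
  · ext a x
    have hl : ∀ a, (H * B) a x = ψ a (B *ᵥ Pi.single x 1) := fun a => by
      rw [rowsOf_mul]; congr 1; ext i; simp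
    have hr : (H * A) a x = ψ a (A *ᵥ Pi.single x 1) := by
      rw [rowsOf_mul]; congr 1; ext i; simp
    rw [hr, Matrix.mul_apply, ← hψ a (by omega)]
    simp only [jordanBlock, Matrix.of_apply, hl]
    cases a using Fin.lastCases with
    | last =>
      rw [Fin.val_last, hψs, LinearMap.zero_apply]
      refine Finset.sum_eq_zero fun c _ => ?_
      have : (c : ℕ) ≠ s + 1 := by omega
      simp [this]
    | cast a =>
      rw [Finset.sum_eq_single a.succ]
      · simp [Fin.ext_iff]
      · intro c _ hc
        have : (c : ℕ) ≠ a + 1 := fun h => hc (Fin.ext (by simpa using h))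
        simp [this]
      · simp
  · simp
  · rw [Matrix.mul_assoc]; exact hdet
  · exact hdet

/-- There are `s + 2` chain vectors, but only the first `s + 1` of the vectors `B v_j` are nonzero,
which matches the shape of `L_{s+1}`. The relations on the `ψ_i` provide the morphism back; no
terminal condition on `ψ_s` is needed. -/
theorem splits_kronecker {A B : Matrix m n ℂ} {s : ℕ} {v : ℕ → n → ℂ}
    {ψ : ℕ → (m → ℂ) →ₗ[ℂ] ℂ}
    (hv0 : A *ᵥ v 0 = 0) (hv : ∀ i < s + 1, A *ᵥ v (i + 1) = B *ᵥ v i)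
    (hvs : B *ᵥ v (s + 1) = 0) (hψ0 : ψ 0 (B *ᵥ v 0) ≠ 0)
    (hψ : ∀ i < s, ∀ x, ψ (i + 1) (B *ᵥ x) = ψ i (A *ᵥ x)) :
    PencilSplits A B (kroneckerConst (s + 1)) (kroneckerLead (s + 1)) := by
  obtain ⟨h1, h2⟩ := pairing hv0 hv hψ0 hψ
  let E : Matrix n (Fin (s + 2)) ℂ := Matrix.of fun x b => v b x
  let F : Matrix m (Fin (s + 1)) ℂ := Matrix.of fun x b => (B *ᵥ v b) x
  let H : Matrix (Fin (s + 1)) m ℂ := rowsOf fun a : Fin (s + 1) => ψ a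
  -- The functionals on the column space are `ψ_0 B, …, ψ_s B, ψ_s A`. By the dual chain relation,
  -- `φ_{a+1} = ψ_a A` for every `a`, not only for the last one.
  let φ : Fin (s + 2) → (n → ℂ) →ₗ[ℂ] ℂ :=
    Fin.lastCases (ψ s ∘ₗ A.mulVecLin) fun a : Fin (s + 1) => ψ a ∘ₗ B.mulVecLin
  have hφl : ∀ a : Fin (s + 1), φ a.castSucc = ψ a ∘ₗ B.mulVecLin := fun a => by simp [φ]
  have hφc : ∀ a : Fin (s + 1), φ a.succ = ψ a ∘ₗ A.mulVecLin := by
    intro a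
    cases a using Fin.lastCases with
    | last => simp [φ, Fin.succ_last]
    | cast a =>
      rw [Fin.succ_castSucc, hφl]
      exact LinearMap.ext fun x => hψ a (by omega) x
  have hGE : ∀ i j, (rowsOf φ * E) i j = φ i (v j) := fun i j => rowsOf_mul _ _ _ _
  have hHF : ∀ i j, (H * F) i j = ψ i (B *ᵥ v j) := fun i j => rowsOf_mul _ _ _ _
  refine PencilSplits.of_isUnit_det (E := E) (F := F) (G := rowsOf φ) (H := H) ?_ ?_ ?_ ?_ ?_ ?_
  · ext x b
    rw [mul_colsOf, Matrix.mul_apply]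
    simp only [kroneckerConst, Matrix.of_apply]
    cases b using Fin.cases with
    | zero =>
      rw [Fin.val_zero, hv0]
      exact (Finset.sum_eq_zero fun c _ => by
        rw [if_neg (Fin.succ_ne_zero c).symm, mul_zero]).symm
    | succ b => rw [Fin.val_succ, hv b (by omega)]; simp [F]
  · ext x b
    rw [mul_colsOf, Matrix.mul_apply]
    simp only [kroneckerLead, Matrix.of_apply]
    cases b using Fin.lastCases with
    | last =>
      rw [Fin.val_last, hvs, Finset.sum_eq_zero]
      · rfl
      · intro c _
        rw [if_neg (Fin.castSucc_lt_last c).ne', mul_zero]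
    | cast b => simp [F]
  · ext a x
    rw [rowsOf_mul, Matrix.mul_apply]
    simp only [kroneckerConst, Matrix.of_apply, ite_mul, one_mul, zero_mul, Finset.sum_ite_eq',
      Finset.mem_univ, if_true]
    change φ a.succ _ = _
    rw [hφc, LinearMap.comp_apply]
    congr 1; ext i; simp
  · ext a x
    rw [rowsOf_mul, Matrix.mul_apply]
    simp only [kroneckerLead, Matrix.of_apply, ite_mul, one_mul, zero_mul, Finset.sum_ite_eq',
      Finset.mem_univ, if_true]
    change φ a.castSucc _ = _
    rw [hφl, LinearMap.comp_apply]
    congr 1; ext i; simp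
  · refine isUnit_det_of_pairing (fun i j hij => ?_) (fun i => ?_)
    · rw [hGE]
      cases i using Fin.cases with
      | zero => exact absurd hij (by simp)
      | succ i =>
        rw [hφc, LinearMap.comp_apply, Matrix.mulVecLin_apply]
        cases j using Fin.cases with
        | zero => rw [Fin.val_zero, hv0, map_zero]
        | succ j =>
          rw [Fin.val_succ, hv j (by omega)]
          exact h1 i (by omega) j (by omega) (by simpa using hij)
    · rw [hGE]
      cases i using Fin.cases with
      | zero =>
        rw [← Fin.castSucc_zero, hφl]; exact hψ0
      | succ i =>
        rw [hφc, LinearMap.comp_apply, Matrix.mulVecLin_apply, Fin.val_succ, hv i (by omega)]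
        exact h2 i (by omega) (by omega)
  · exact isUnit_det_of_pairing
      (fun i j hij => by rw [hHF]; exact h1 i (by omega) j (by omega) hij)
      (fun i => by rw [hHF]; exact h2 i (by omega) (by omega))

theorem splits_kronecker_zero {A B : Matrix m n ℂ} {v : n → ℂ} (hv : v ≠ 0) (hA : A *ᵥ v = 0)
    (hB : B *ᵥ v = 0) : PencilSplits A B (kroneckerConst 0) (kroneckerLead 0) := by
  obtain ⟨x, hx⟩ := Function.ne_iff.1 hv
  refine PencilSplits.of_isUnit_det (E := Matrix.of fun x _ => v x) (F := 0)
    (G := Matrix.of fun _ y => (Pi.single x 1 : n → ℂ) y) (H := 0) ?_ ?_ ?_ ?_ ?_ ?_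
  · ext i b
    simpa [Matrix.mul_apply, Matrix.mulVec, dotProduct] using congrFun hA i
  · ext i b
    simpa [Matrix.mul_apply, Matrix.mulVec, dotProduct] using congrFun hB i
  · ext i; exact i.elim0
  · ext i; exact i.elim0
  · rw [Matrix.det_fin_one, isUnit_iff_ne_zero]
    simpa [Matrix.mul_apply, Pi.single_apply] using hx
  · simp

/-- If `A` has a nontrivial kernel then the pencil `A - λ B` splits off a singular block `L_j` or a
Jordan block for the eigenvalue zero. -/
theorem splits_of_ker {A B : Matrix m n ℂ} {v₀ : n → ℂ} (hv₀ : v₀ ≠ 0) (hA : A *ᵥ v₀ = 0) :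
    (∃ j, PencilSplits A B (kroneckerConst j) (kroneckerLead j)) ∨
      ∃ s, PencilSplits A B (jordanBlock 0 (s + 1)) 1 := by
  classical
  let a := A.mulVecLin
  let b := B.mulVecLin
  -- The question is whether a chain from some kernel vector of `A` closes up. If so, minimality of
  -- its length `k` provides the dual chain, and the block is `L_k`.
  by_cases hsing : ∃ k, ∃ v : n → ℂ, v ≠ 0 ∧ a v = 0 ∧ b v ∈ iter a b ⊥ k
  · left
    obtain ⟨v, hv, hav, hbv⟩ := Nat.find_spec hsing
    have hmin := fun k (hk : k < Nat.find hsing) => Nat.find_min hsing hk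
    generalize Nat.find hsing = k at hbv hmin
    refine ⟨k, ?_⟩
    cases k with
    | zero => exact splits_kronecker_zero hv hav hbv
    | succ k =>
      have hnot : b v ∉ iter a b ⊥ k := fun h => hmin k (by omega) ⟨v, hv, hav, h⟩
      obtain ⟨v, rfl, h1, h2⟩ := exists_chain _ hbv
      obtain ⟨ψ, h3, h4, -⟩ := exists_dual_chain_of_notMem _ hnot
      exact splits_kronecker hav h1 h2 h3 h4
  · right
    push Not at hsing
    -- No chain closes up, so chains from `v₀` have bounded length. The first unreachable index is
    -- positive because `iter` starts at `⊤`, and it is the size of the Jordan block.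
    have hfin : ∃ k, b v₀ ∉ iter a b ⊤ k := by
      by_contra! hcon
      obtain ⟨k, hk⟩ := exists_mem_iter_bot hv₀ hA hcon
      exact hsing k v₀ hv₀ hA hk
    have hnot := Nat.find_spec hfin
    have hmin := fun k (hk : k < Nat.find hfin) => Nat.find_min hfin hk
    generalize Nat.find hfin = k at hnot hmin
    cases k with
    | zero => exact absurd Submodule.mem_top hnot
    | succ k =>
      have hin : b v₀ ∈ iter a b ⊤ k := not_not.1 (hmin k (by omega))
      obtain ⟨v, rfl, h1, -⟩ := exists_chain _ hin
      obtain ⟨ψ, h3, h4, h5⟩ := exists_dual_chain_of_notMem _ hnot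
      exact ⟨k, splits_jordanBlock hA h1 h3 h4
        (LinearMap.ext fun w => h5 w Submodule.mem_top)⟩

end Matrices

end PencilChain

/-! ### Symmetries of the blocks, and the existence of a block to split off -/

theorem jordanBlock_add_smul (ρ : ℂ) (s : ℕ) : jordanBlock 0 s + ρ • 1 = jordanBlock ρ s := by
  ext i j
  simp only [jordanBlock, Matrix.add_apply, Matrix.of_apply, Matrix.smul_apply, Matrix.one_apply,
    eq_comm (a := i)]
  split_ifs <;> simp

theorem jordanBlock_transpose (μ : ℂ) (s : ℕ) :
    (jordanBlock μ s)ᵀ.submatrix Fin.revPerm Fin.revPerm = jordanBlock μ s := by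
  ext i j
  simp only [jordanBlock, Matrix.submatrix_apply, Matrix.transpose_apply, Matrix.of_apply,
    Fin.revPerm_apply, Fin.rev_inj, eq_comm (a := i), Fin.val_rev]
  congr 2
  simp only [eq_iff_iff]
  omega

theorem kroneckerLead_rev (j : ℕ) :
    (kroneckerLead j).submatrix Fin.revPerm Fin.revPerm = kroneckerConst j := by
  ext a b
  simp only [kroneckerLead, kroneckerConst, Matrix.submatrix_apply, Matrix.of_apply,
    Fin.revPerm_apply, Fin.ext_iff, Fin.val_rev, Fin.val_castSucc, Fin.val_succ]
  congr 1
  simp only [eq_iff_iff]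
  omega

theorem kroneckerConst_rev (j : ℕ) :
    (kroneckerConst j).submatrix Fin.revPerm Fin.revPerm = kroneckerLead j := by
  ext a b
  simp only [kroneckerLead, kroneckerConst, Matrix.submatrix_apply, Matrix.of_apply,
    Fin.revPerm_apply, Fin.ext_iff, Fin.val_rev, Fin.val_castSucc, Fin.val_succ]
  congr 1
  simp only [eq_iff_iff]
  omega

theorem pencilEquiv_jordanBlock_transpose (μ : ℂ) (s : ℕ) :
    PencilEquiv (jordanBlock μ s)ᵀ 1 (jordanBlock μ s) 1 := by
  simpa [jordanBlock_transpose] using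
    PencilEquiv.submatrix (jordanBlock μ s)ᵀ 1 Fin.revPerm Fin.revPerm

theorem pencilEquiv_kronecker_swap (j : ℕ) :
    PencilEquiv (kroneckerLead j) (kroneckerConst j) (kroneckerConst j) (kroneckerLead j) := by
  simpa only [kroneckerLead_rev, kroneckerConst_rev] using
    PencilEquiv.submatrix (kroneckerLead j) (kroneckerConst j) Fin.revPerm Fin.revPerm

section

variable {m n : Type*} [Fintype m] [Fintype n] [DecidableEq m] [DecidableEq n]

/-- The last column of `[I_j 0]` vanishes. This rules out blocks `L_j` when `B` is injective. -/
theorem PencilSplits.exists_ker {A B : Matrix m n ℂ} {j : ℕ}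
    (h : PencilSplits A B (kroneckerConst j) (kroneckerLead j)) : ∃ v ≠ 0, B *ᵥ v = 0 := by
  obtain ⟨p, q, A', B', P, P', Q, Q', h1, h2, h3, h4, -, h6⟩ := h
  set w : Fin (j + 1) ⊕ Fin q → ℂ := Pi.single (Sum.inl (Fin.last j)) 1 with hw
  have hw0 : w ≠ 0 := by simp [hw]
  refine ⟨Q *ᵥ w, fun h0 => hw0 ?_, ?_⟩
  · rw [← Matrix.one_mulVec w, ← h4, ← Matrix.mulVec_mulVec, h0, Matrix.mulVec_zero]
  · have : (P * B * Q) *ᵥ w = 0 := by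
      rw [h6, hw, Matrix.mulVec_single_one]
      ext (i | i)
      · simp [kroneckerLead, (Fin.castSucc_lt_last i).ne']
      · simp
    rw [← Matrix.one_mulVec (B *ᵥ _), ← h2, Matrix.mulVec_mulVec, Matrix.mulVec_mulVec,
      Matrix.mul_assoc, Matrix.mul_assoc, ← Matrix.mul_assoc P, ← Matrix.mulVec_mulVec, this,
      Matrix.mulVec_zero]

/-- A kernel vector of `B` is handled by exchanging the coefficients. Otherwise `B` is injective,
hence bijective by the size condition, and an eigenvalue `ρ` of `B⁻¹ A` makes `A - ρ B` singular. -/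
theorem pencilSplits_of_card_le [Nonempty n] (A B : Matrix m n ℂ)
    (hcard : Fintype.card m ≤ Fintype.card n) :
    (∃ ρ s, PencilSplits A B (jordanBlock ρ (s + 1)) 1) ∨
    (∃ s, PencilSplits A B 1 (jordanBlock 0 (s + 1))) ∨
    ∃ j, PencilSplits A B (kroneckerConst j) (kroneckerLead j) := by
  by_cases hB : ∃ v ≠ 0, B *ᵥ v = 0
  · obtain ⟨v, hv, hBv⟩ := hB
    rcases PencilChain.splits_of_ker (B := A) hv hBv with ⟨j, h⟩ | ⟨s, h⟩
    · exact Or.inr (Or.inr ⟨j, h.swap.congr (pencilEquiv_kronecker_swap j)⟩)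
    · exact Or.inr (Or.inl ⟨s, h.swap⟩)
  · have hinj : Function.Injective B.mulVecLin := by
      rw [← LinearMap.ker_eq_bot, LinearMap.ker_eq_bot']
      intro v hv
      by_contra h0
      exact hB ⟨v, h0, hv⟩
    have hdim : Module.finrank ℂ (n → ℂ) = Module.finrank ℂ (m → ℂ) := by
      have := LinearMap.finrank_le_finrank_of_injective hinj
      simp only [Module.finrank_fintype_fun_eq_card] at this ⊢
      omega
    let β := LinearEquiv.ofInjectiveOfFinrankEq B.mulVecLin hinj hdim
    obtain ⟨ρ, hρ⟩ := Module.End.exists_eigenvalue (K := ℂ)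
      (β.symm.toLinearMap ∘ₗ A.mulVecLin : Module.End ℂ (n → ℂ))
    obtain ⟨v, hv⟩ := hρ.exists_hasEigenvector
    have hAv : A *ᵥ v = ρ • B *ᵥ v := by
      have h1 : β.symm (A *ᵥ v) = ρ • v := hv.apply_eq_smul
      have h2 := congrArg β h1
      rw [LinearEquiv.apply_symm_apply, map_smul] at h2
      exact h2
    have hker : (A - ρ • B) *ᵥ v = 0 := by
      rw [Matrix.sub_mulVec, Matrix.smul_mulVec, hAv, sub_self]
    rcases PencilChain.splits_of_ker (B := B) hv.2 hker with ⟨j, h⟩ | ⟨s, h⟩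
    · exact absurd h.exists_ker hB
    · refine Or.inl ⟨ρ, s, ?_⟩
      have := h.add_smul ρ
      rwa [sub_add_cancel, jordanBlock_add_smul] at this

theorem pencilSplits_of_card_pos (A B : Matrix m n ℂ)
    (hcard : 0 < Fintype.card m + Fintype.card n) :
    (∃ ρ s, PencilSplits A B (jordanBlock ρ (s + 1)) 1) ∨
    (∃ s, PencilSplits A B 1 (jordanBlock 0 (s + 1))) ∨
    (∃ j, PencilSplits A B (kroneckerConst j) (kroneckerLead j)) ∨
    ∃ j, PencilSplits A B (kroneckerConst j)ᵀ (kroneckerLead j)ᵀ := by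
  rcases le_total (Fintype.card m) (Fintype.card n) with hle | hle
  · have : Nonempty n := Fintype.card_pos_iff.1 (by omega)
    rcases pencilSplits_of_card_le A B hle with h | h | h
    · exact Or.inl h
    · exact Or.inr (Or.inl h)
    · exact Or.inr (Or.inr (Or.inl h))
  · have : Nonempty m := Fintype.card_pos_iff.1 (by omega)
    rcases pencilSplits_of_card_le Aᵀ Bᵀ hle with ⟨ρ, s, h⟩ | ⟨s, h⟩ | ⟨j, h⟩
    · refine Or.inl ⟨ρ, s, ?_⟩
      simpa using h.transpose.congr (by simpa using pencilEquiv_jordanBlock_transpose ρ (s + 1))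
    · refine Or.inr (Or.inl ⟨s, ?_⟩)
      simpa using h.transpose.congr
        (by simpa using (pencilEquiv_jordanBlock_transpose 0 (s + 1)).swap)
    · exact Or.inr (Or.inr (Or.inr ⟨j, by simpa using h.transpose⟩))

end

/-! ### Rearranging direct sums of blocks -/

theorem blockDiagonal'_comp {ι κ : Type*} [DecidableEq ι] [DecidableEq κ] {β γ : κ → Type*}
    (M : ∀ i, Matrix (β i) (γ i) ℂ) {f : ι → κ} (hf : Function.Injective f) (i j : ι)
    (a : β (f i)) (b : γ (f j)) :
    blockDiagonal' M ⟨f i, a⟩ ⟨f j, b⟩ = blockDiagonal' (fun i => M (f i)) ⟨i, a⟩ ⟨j, b⟩ := by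
  by_cases h : i = j
  · subst h
    rw [blockDiagonal'_apply_eq, blockDiagonal'_apply_eq]
  · rw [blockDiagonal'_apply_ne _ _ _ (hf.ne h), blockDiagonal'_apply_ne _ _ _ h]

theorem blockDiagonal'_sum {ι κ : Type*} [DecidableEq ι] [DecidableEq κ] {β γ : ι ⊕ κ → Type*}
    (M : ∀ i, Matrix (β i) (γ i) ℂ) :
    (fromBlocks (blockDiagonal' fun i => M (Sum.inl i)) 0
      0 (blockDiagonal' fun i => M (Sum.inr i))).submatrix (Equiv.sumSigmaDistrib β)
      (Equiv.sumSigmaDistrib γ) = blockDiagonal' M := by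
  ext ⟨i | i, a⟩ ⟨j | j, b⟩
  · exact (blockDiagonal'_comp M Sum.inl_injective i j a b).symm
  · exact (blockDiagonal'_apply_ne M a b Sum.inl_ne_inr).symm
  · exact (blockDiagonal'_apply_ne M a b Sum.inr_ne_inl).symm
  · exact (blockDiagonal'_comp M Sum.inr_injective i j a b).symm

/-- The direct sum of four block diagonal matrices. -/
def quadDiagonal {ι₁ ι₂ ι₃ ι₄ : Type*} [DecidableEq ι₁] [DecidableEq ι₂] [DecidableEq ι₃]
    [DecidableEq ι₄] {β₁ γ₁ : ι₁ → Type*} {β₂ γ₂ : ι₂ → Type*} {β₃ γ₃ : ι₃ → Type*}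
    {β₄ γ₄ : ι₄ → Type*} (M₁ : ∀ i, Matrix (β₁ i) (γ₁ i) ℂ) (M₂ : ∀ i, Matrix (β₂ i) (γ₂ i) ℂ)
    (M₃ : ∀ i, Matrix (β₃ i) (γ₃ i) ℂ) (M₄ : ∀ i, Matrix (β₄ i) (γ₄ i) ℂ) :
    Matrix (((Σ i, β₁ i) ⊕ (Σ i, β₂ i)) ⊕ ((Σ i, β₃ i) ⊕ (Σ i, β₄ i)))
      (((Σ i, γ₁ i) ⊕ (Σ i, γ₂ i)) ⊕ ((Σ i, γ₃ i) ⊕ (Σ i, γ₄ i))) ℂ :=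
  fromBlocks (fromBlocks (blockDiagonal' M₁) 0 0 (blockDiagonal' M₂)) 0
    0 (fromBlocks (blockDiagonal' M₃) 0 0 (blockDiagonal' M₄))

/-- Sorting the block positions of a direct sum by summand. -/
def sumSigmaEquiv {ι₁ ι₂ ι₃ ι₄ κ₁ κ₂ κ₃ κ₄ : Type*} (β₁ : ι₁ ⊕ κ₁ → Type*) (β₂ : ι₂ ⊕ κ₂ → Type*)
    (β₃ : ι₃ ⊕ κ₃ → Type*) (β₄ : ι₄ ⊕ κ₄ → Type*) :
    ((Σ i, β₁ i) ⊕ (Σ i, β₂ i)) ⊕ ((Σ i, β₃ i) ⊕ (Σ i, β₄ i)) ≃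
    (((Σ i, β₁ (Sum.inl i)) ⊕ (Σ i, β₂ (Sum.inl i))) ⊕
      ((Σ i, β₃ (Sum.inl i)) ⊕ (Σ i, β₄ (Sum.inl i)))) ⊕
    (((Σ i, β₁ (Sum.inr i)) ⊕ (Σ i, β₂ (Sum.inr i))) ⊕
      ((Σ i, β₃ (Sum.inr i)) ⊕ (Σ i, β₄ (Sum.inr i)))) :=
  ((Equiv.sumCongr (Equiv.sumCongr (Equiv.sumSigmaDistrib β₁) (Equiv.sumSigmaDistrib β₂))
    (Equiv.sumCongr (Equiv.sumSigmaDistrib β₃) (Equiv.sumSigmaDistrib β₄))).trans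
    (Equiv.sumCongr (Equiv.sumSumSumComm _ _ _ _) (Equiv.sumSumSumComm _ _ _ _))).trans
    (Equiv.sumSumSumComm _ _ _ _)

theorem quadDiagonal_sum {ι₁ ι₂ ι₃ ι₄ κ₁ κ₂ κ₃ κ₄ : Type*} [DecidableEq ι₁] [DecidableEq ι₂]
    [DecidableEq ι₃] [DecidableEq ι₄] [DecidableEq κ₁] [DecidableEq κ₂]
    [DecidableEq κ₃] [DecidableEq κ₄] {β₁ γ₁ : ι₁ ⊕ κ₁ → Type*} {β₂ γ₂ : ι₂ ⊕ κ₂ → Type*}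
    {β₃ γ₃ : ι₃ ⊕ κ₃ → Type*} {β₄ γ₄ : ι₄ ⊕ κ₄ → Type*}
    (M₁ : ∀ i, Matrix (β₁ i) (γ₁ i) ℂ) (M₂ : ∀ i, Matrix (β₂ i) (γ₂ i) ℂ)
    (M₃ : ∀ i, Matrix (β₃ i) (γ₃ i) ℂ) (M₄ : ∀ i, Matrix (β₄ i) (γ₄ i) ℂ) :
    (fromBlocks
      (quadDiagonal (fun i => M₁ (Sum.inl i)) (fun i => M₂ (Sum.inl i)) (fun i => M₃ (Sum.inl i))
        (fun i => M₄ (Sum.inl i))) 0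
      0 (quadDiagonal (fun i => M₁ (Sum.inr i)) (fun i => M₂ (Sum.inr i))
        (fun i => M₃ (Sum.inr i)) (fun i => M₄ (Sum.inr i)))).submatrix
      (sumSigmaEquiv β₁ β₂ β₃ β₄) (sumSigmaEquiv γ₁ γ₂ γ₃ γ₄) = quadDiagonal M₁ M₂ M₃ M₄ := by
  conv_rhs => rw [quadDiagonal, ← blockDiagonal'_sum M₁, ← blockDiagonal'_sum M₂,
    ← blockDiagonal'_sum M₃, ← blockDiagonal'_sum M₄]
  ext (((⟨i | i, a⟩ | ⟨i | i, a⟩) | (⟨i | i, a⟩ | ⟨i | i, a⟩)))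
    (((⟨j | j, b⟩ | ⟨j | j, b⟩) | (⟨j | j, b⟩ | ⟨j | j, b⟩))) <;> rfl

/-- Renumbering the blocks of a direct sum. -/
def quadSigmaCongr {ι₁ ι₂ ι₃ ι₄ κ₁ κ₂ κ₃ κ₄ : Type*} (e₁ : κ₁ ≃ ι₁) (e₂ : κ₂ ≃ ι₂) (e₃ : κ₃ ≃ ι₃)
    (e₄ : κ₄ ≃ ι₄) (β₁ : ι₁ → Type*) (β₂ : ι₂ → Type*) (β₃ : ι₃ → Type*) (β₄ : ι₄ → Type*) :
    ((Σ i, β₁ (e₁ i)) ⊕ (Σ i, β₂ (e₂ i))) ⊕ ((Σ i, β₃ (e₃ i)) ⊕ (Σ i, β₄ (e₄ i))) ≃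
    ((Σ i, β₁ i) ⊕ (Σ i, β₂ i)) ⊕ ((Σ i, β₃ i) ⊕ (Σ i, β₄ i)) :=
  Equiv.sumCongr (Equiv.sumCongr (Equiv.sigmaCongrLeft e₁) (Equiv.sigmaCongrLeft e₂))
    (Equiv.sumCongr (Equiv.sigmaCongrLeft e₃) (Equiv.sigmaCongrLeft e₄))

theorem quadDiagonal_congr {ι₁ ι₂ ι₃ ι₄ κ₁ κ₂ κ₃ κ₄ : Type*} [DecidableEq ι₁] [DecidableEq ι₂]
    [DecidableEq ι₃] [DecidableEq ι₄] [DecidableEq κ₁] [DecidableEq κ₂]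
    [DecidableEq κ₃] [DecidableEq κ₄] (e₁ : κ₁ ≃ ι₁) (e₂ : κ₂ ≃ ι₂) (e₃ : κ₃ ≃ ι₃)
    (e₄ : κ₄ ≃ ι₄) {β₁ γ₁ : ι₁ → Type*} {β₂ γ₂ : ι₂ → Type*} {β₃ γ₃ : ι₃ → Type*}
    {β₄ γ₄ : ι₄ → Type*} (M₁ : ∀ i, Matrix (β₁ i) (γ₁ i) ℂ) (M₂ : ∀ i, Matrix (β₂ i) (γ₂ i) ℂ)
    (M₃ : ∀ i, Matrix (β₃ i) (γ₃ i) ℂ) (M₄ : ∀ i, Matrix (β₄ i) (γ₄ i) ℂ) :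
    (quadDiagonal M₁ M₂ M₃ M₄).submatrix (quadSigmaCongr e₁ e₂ e₃ e₄ β₁ β₂ β₃ β₄)
      (quadSigmaCongr e₁ e₂ e₃ e₄ γ₁ γ₂ γ₃ γ₄) =
    quadDiagonal (fun i => M₁ (e₁ i)) (fun i => M₂ (e₂ i)) (fun i => M₃ (e₃ i))
      (fun i => M₄ (e₄ i)) := by
  ext ((⟨i, a⟩ | ⟨i, a⟩) | (⟨i, a⟩ | ⟨i, a⟩)) ((⟨j, b⟩ | ⟨j, b⟩) | (⟨j, b⟩ | ⟨j, b⟩))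
  case inl.inl.inl.inl => exact blockDiagonal'_comp M₁ e₁.injective i j a b
  case inl.inr.inl.inr => exact blockDiagonal'_comp M₂ e₂.injective i j a b
  case inr.inl.inr.inl => exact blockDiagonal'_comp M₃ e₃.injective i j a b
  case inr.inr.inr.inr => exact blockDiagonal'_comp M₄ e₄.injective i j a b
  all_goals rfl

/-! ### Block data and existence of the Kronecker canonical form -/

/-- Kronecker block data as in `KroneckerForm`, with the blocks of each kind indexed by any finite
type. -/
structure PencilBlocks where
  Finite : Type
  Infinite : Type
  Right : Type
  Left : Type
  [fintypeFinite : Fintype Finite]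
  [fintypeInfinite : Fintype Infinite]
  [fintypeRight : Fintype Right]
  [fintypeLeft : Fintype Left]
  [decEqFinite : DecidableEq Finite]
  [decEqInfinite : DecidableEq Infinite]
  [decEqRight : DecidableEq Right]
  [decEqLeft : DecidableEq Left]
  eigenvalue : Finite → ℂ
  finSize : Finite → ℕ
  finSize_pos : ∀ i, 0 < finSize i
  infSize : Infinite → ℕ
  infSize_pos : ∀ i, 0 < infSize i
  right : Right → ℕ
  left : Left → ℕ

namespace PencilBlocks

attribute [instance] fintypeFinite fintypeInfinite fintypeRight fintypeLeft decEqFinite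
  decEqInfinite decEqRight decEqLeft

/-- The positions of the rows. -/
abbrev Row (K : PencilBlocks) : Type :=
  ((Σ i, Fin (K.finSize i)) ⊕ (Σ i, Fin (K.infSize i))) ⊕
    ((Σ i, Fin (K.right i)) ⊕ (Σ i, Fin (K.left i + 1)))

/-- The positions of the columns. -/
abbrev Col (K : PencilBlocks) : Type :=
  ((Σ i, Fin (K.finSize i)) ⊕ (Σ i, Fin (K.infSize i))) ⊕
    ((Σ i, Fin (K.right i + 1)) ⊕ (Σ i, Fin (K.left i)))

instance (K : PencilBlocks) : DecidableEq K.Row := instDecidableEqSum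

instance (K : PencilBlocks) : DecidableEq K.Col := instDecidableEqSum

/-- The constant coefficient of the block diagonal pencil. -/
def const (K : PencilBlocks) : Matrix K.Row K.Col ℂ :=
  quadDiagonal (fun i => jordanBlock (K.eigenvalue i) (K.finSize i)) (fun _ => 1)
    (fun i => kroneckerConst (K.right i)) (fun i => (kroneckerConst (K.left i))ᵀ)

/-- The leading coefficient of the block diagonal pencil. -/
def lead (K : PencilBlocks) : Matrix K.Row K.Col ℂ :=
  quadDiagonal (fun _ => 1) (fun i => jordanBlock 0 (K.infSize i))
    (fun i => kroneckerLead (K.right i)) (fun i => (kroneckerLead (K.left i))ᵀ)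

/-- The direct sum of two block diagonal pencils. -/
def sum (K L : PencilBlocks) : PencilBlocks where
  Finite := K.Finite ⊕ L.Finite
  Infinite := K.Infinite ⊕ L.Infinite
  Right := K.Right ⊕ L.Right
  Left := K.Left ⊕ L.Left
  eigenvalue := Sum.elim K.eigenvalue L.eigenvalue
  finSize := Sum.elim K.finSize L.finSize
  finSize_pos := Sum.forall.2 ⟨K.finSize_pos, L.finSize_pos⟩
  infSize := Sum.elim K.infSize L.infSize
  infSize_pos := Sum.forall.2 ⟨K.infSize_pos, L.infSize_pos⟩
  right := Sum.elim K.right L.right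
  left := Sum.elim K.left L.left

/-- The row positions of a direct sum. -/
def sumRow (K L : PencilBlocks) : (K.sum L).Row ≃ K.Row ⊕ L.Row :=
  sumSigmaEquiv (fun i => Fin ((K.sum L).finSize i)) (fun i => Fin ((K.sum L).infSize i))
    (fun i => Fin ((K.sum L).right i)) (fun i => Fin ((K.sum L).left i + 1))

/-- The column positions of a direct sum. -/
def sumCol (K L : PencilBlocks) : (K.sum L).Col ≃ K.Col ⊕ L.Col :=
  sumSigmaEquiv (fun i => Fin ((K.sum L).finSize i)) (fun i => Fin ((K.sum L).infSize i))
    (fun i => Fin ((K.sum L).right i + 1)) (fun i => Fin ((K.sum L).left i))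

theorem fromBlocks_const (K L : PencilBlocks) :
    (fromBlocks K.const 0 0 L.const).submatrix (K.sumRow L) (K.sumCol L) = (K.sum L).const :=
  quadDiagonal_sum (fun i => jordanBlock ((K.sum L).eigenvalue i) ((K.sum L).finSize i))
    (fun _ => 1) (fun i => kroneckerConst ((K.sum L).right i))
    (fun i => (kroneckerConst ((K.sum L).left i))ᵀ)

theorem fromBlocks_lead (K L : PencilBlocks) :
    (fromBlocks K.lead 0 0 L.lead).submatrix (K.sumRow L) (K.sumCol L) = (K.sum L).lead :=
  quadDiagonal_sum (fun _ => 1) (fun i => jordanBlock 0 ((K.sum L).infSize i))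
    (fun i => kroneckerLead ((K.sum L).right i)) (fun i => (kroneckerLead ((K.sum L).left i))ᵀ)

/-- A single Jordan block with a finite eigenvalue. -/
def singleFinite (μ : ℂ) (s : ℕ) : PencilBlocks where
  Finite := Unit
  Infinite := Empty
  Right := Empty
  Left := Empty
  eigenvalue _ := μ
  finSize _ := s + 1
  finSize_pos _ := s.succ_pos
  infSize := Empty.elim
  infSize_pos i := i.elim
  right := Empty.elim
  left := Empty.elim

/-- A single Jordan block with the infinite eigenvalue. -/
def singleInfinite (s : ℕ) : PencilBlocks where
  Finite := Empty
  Infinite := Unit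
  Right := Empty
  Left := Empty
  eigenvalue := Empty.elim
  finSize := Empty.elim
  finSize_pos i := i.elim
  infSize _ := s + 1
  infSize_pos _ := s.succ_pos
  right := Empty.elim
  left := Empty.elim

/-- A single block `L_j`. -/
def singleRight (j : ℕ) : PencilBlocks where
  Finite := Empty
  Infinite := Empty
  Right := Unit
  Left := Empty
  eigenvalue := Empty.elim
  finSize := Empty.elim
  finSize_pos i := i.elim
  infSize := Empty.elim
  infSize_pos i := i.elim
  right _ := j
  left := Empty.elim

/-- A single block `L_jᵀ`. -/
def singleLeft (j : ℕ) : PencilBlocks where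
  Finite := Empty
  Infinite := Empty
  Right := Empty
  Left := Unit
  eigenvalue := Empty.elim
  finSize := Empty.elim
  finSize_pos i := i.elim
  infSize := Empty.elim
  infSize_pos i := i.elim
  right := Empty.elim
  left _ := j

theorem pencilEquiv_of_bijective {m n : Type*} [Fintype m] [Fintype n] [DecidableEq m]
    [DecidableEq n] {A B : Matrix m n ℂ} {K : PencilBlocks} (f : m → K.Row) (g : n → K.Col)
    (hf : f.Bijective) (hg : g.Bijective) (hA : ∀ i j, K.const (f i) (g j) = A i j)
    (hB : ∀ i j, K.lead (f i) (g j) = B i j) : PencilEquiv A B K.const K.lead := by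
  have h := PencilEquiv.submatrix K.const K.lead (Equiv.ofBijective f hf) (Equiv.ofBijective g hg)
  have hA' : K.const.submatrix (Equiv.ofBijective f hf) (Equiv.ofBijective g hg) = A :=
    Matrix.ext hA
  have hB' : K.lead.submatrix (Equiv.ofBijective f hf) (Equiv.ofBijective g hg) = B :=
    Matrix.ext hB
  rw [hA', hB'] at h
  exact h.symm

theorem pencilEquiv_singleFinite (μ : ℂ) (s : ℕ) :
    PencilEquiv (jordanBlock μ (s + 1)) 1 (singleFinite μ s).const (singleFinite μ s).lead := by
  refine pencilEquiv_of_bijective (fun a => Sum.inl (Sum.inl ⟨(), a⟩))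
    (fun a => Sum.inl (Sum.inl ⟨(), a⟩)) ⟨?_, ?_⟩ ⟨?_, ?_⟩ ?_ ?_
  · intro a b h; exact eq_of_heq (Sigma.mk.inj (Sum.inl.inj (Sum.inl.inj h))).2
  · rintro ((⟨⟨⟩, a⟩ | ⟨⟨⟩, a⟩) | (⟨⟨⟩, a⟩ | ⟨⟨⟩, a⟩)); exact ⟨a, rfl⟩
  · intro a b h; exact eq_of_heq (Sigma.mk.inj (Sum.inl.inj (Sum.inl.inj h))).2
  · rintro ((⟨⟨⟩, a⟩ | ⟨⟨⟩, a⟩) | (⟨⟨⟩, a⟩ | ⟨⟨⟩, a⟩)); exact ⟨a, rfl⟩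
  · intro a b
    exact blockDiagonal'_apply_eq (fun _ : Unit => jordanBlock μ (s + 1)) () _ _
  · intro a b
    exact blockDiagonal'_apply_eq (fun _ : Unit => (1 : Matrix (Fin (s + 1)) (Fin (s + 1)) ℂ)) () _ _

theorem pencilEquiv_singleInfinite (s : ℕ) :
    PencilEquiv 1 (jordanBlock 0 (s + 1)) (singleInfinite s).const (singleInfinite s).lead := by
  refine pencilEquiv_of_bijective (fun a => Sum.inl (Sum.inr ⟨(), a⟩))
    (fun a => Sum.inl (Sum.inr ⟨(), a⟩)) ⟨?_, ?_⟩ ⟨?_, ?_⟩ ?_ ?_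
  · intro a b h; exact eq_of_heq (Sigma.mk.inj (Sum.inr.inj (Sum.inl.inj h))).2
  · rintro ((⟨⟨⟩, a⟩ | ⟨⟨⟩, a⟩) | (⟨⟨⟩, a⟩ | ⟨⟨⟩, a⟩)); exact ⟨a, rfl⟩
  · intro a b h; exact eq_of_heq (Sigma.mk.inj (Sum.inr.inj (Sum.inl.inj h))).2
  · rintro ((⟨⟨⟩, a⟩ | ⟨⟨⟩, a⟩) | (⟨⟨⟩, a⟩ | ⟨⟨⟩, a⟩)); exact ⟨a, rfl⟩
  · intro a b
    exact blockDiagonal'_apply_eq (fun _ : Unit => (1 : Matrix (Fin (s + 1)) (Fin (s + 1)) ℂ)) () _ _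
  · intro a b
    exact blockDiagonal'_apply_eq (fun _ : Unit => jordanBlock 0 (s + 1)) () _ _

theorem pencilEquiv_singleRight (j : ℕ) :
    PencilEquiv (kroneckerConst j) (kroneckerLead j) (singleRight j).const (singleRight j).lead := by
  refine pencilEquiv_of_bijective (fun a => Sum.inr (Sum.inl ⟨(), a⟩))
    (fun a => Sum.inr (Sum.inl ⟨(), a⟩)) ⟨?_, ?_⟩ ⟨?_, ?_⟩ ?_ ?_
  · intro a b h; exact eq_of_heq (Sigma.mk.inj (Sum.inl.inj (Sum.inr.inj h))).2
  · rintro ((⟨⟨⟩, a⟩ | ⟨⟨⟩, a⟩) | (⟨⟨⟩, a⟩ | ⟨⟨⟩, a⟩)); exact ⟨a, rfl⟩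
  · intro a b h; exact eq_of_heq (Sigma.mk.inj (Sum.inl.inj (Sum.inr.inj h))).2
  · rintro ((⟨⟨⟩, a⟩ | ⟨⟨⟩, a⟩) | (⟨⟨⟩, a⟩ | ⟨⟨⟩, a⟩)); exact ⟨a, rfl⟩
  · intro a b
    exact blockDiagonal'_apply_eq (fun _ : Unit => kroneckerConst j) () _ _
  · intro a b
    exact blockDiagonal'_apply_eq (fun _ : Unit => kroneckerLead j) () _ _

theorem pencilEquiv_singleLeft (j : ℕ) :
    PencilEquiv (kroneckerConst j)ᵀ (kroneckerLead j)ᵀ (singleLeft j).const (singleLeft j).lead := by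
  refine pencilEquiv_of_bijective (fun a => Sum.inr (Sum.inr ⟨(), a⟩))
    (fun a => Sum.inr (Sum.inr ⟨(), a⟩)) ⟨?_, ?_⟩ ⟨?_, ?_⟩ ?_ ?_
  · intro a b h; exact eq_of_heq (Sigma.mk.inj (Sum.inr.inj (Sum.inr.inj h))).2
  · rintro ((⟨⟨⟩, a⟩ | ⟨⟨⟩, a⟩) | (⟨⟨⟩, a⟩ | ⟨⟨⟩, a⟩)); exact ⟨a, rfl⟩
  · intro a b h; exact eq_of_heq (Sigma.mk.inj (Sum.inr.inj (Sum.inr.inj h))).2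
  · rintro ((⟨⟨⟩, a⟩ | ⟨⟨⟩, a⟩) | (⟨⟨⟩, a⟩ | ⟨⟨⟩, a⟩)); exact ⟨a, rfl⟩
  · intro a b
    exact blockDiagonal'_apply_eq (fun _ : Unit => (kroneckerConst j)ᵀ) () _ _
  · intro a b
    exact blockDiagonal'_apply_eq (fun _ : Unit => (kroneckerLead j)ᵀ) () _ _

/-- The block diagonal pencil without blocks. -/
def empty : PencilBlocks where
  Finite := Empty
  Infinite := Empty
  Right := Empty
  Left := Empty
  eigenvalue := Empty.elim
  finSize := Empty.elim
  finSize_pos i := i.elim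
  infSize := Empty.elim
  infSize_pos i := i.elim
  right := Empty.elim
  left := Empty.elim

theorem pencilEquiv_empty {m n : Type*} [Fintype m] [Fintype n] [DecidableEq m] [DecidableEq n]
    [IsEmpty m] [IsEmpty n] (A B : Matrix m n ℂ) : PencilEquiv A B empty.const empty.lead := by
  refine pencilEquiv_of_bijective isEmptyElim isEmptyElim ⟨fun a => isEmptyElim a, ?_⟩
    ⟨fun a => isEmptyElim a, ?_⟩ (fun a => isEmptyElim a) (fun a => isEmptyElim a) <;>
  rintro ((⟨⟨⟩, a⟩ | ⟨⟨⟩, a⟩) | (⟨⟨⟩, a⟩ | ⟨⟨⟩, a⟩))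

/-- The induction step. Positivity concerns rows plus columns, since a block `L_0` has one column
and no rows. -/
theorem exists_of_splits {m n r c : Type*} [Fintype m] [Fintype n] [Fintype r] [Fintype c]
    [DecidableEq m] [DecidableEq n] [DecidableEq r] [DecidableEq c] {A B : Matrix m n ℂ}
    {C D : Matrix r c ℂ} {K : PencilBlocks} (h : PencilSplits A B C D)
    (hK : PencilEquiv C D K.const K.lead) (hpos : 0 < Fintype.card r + Fintype.card c)
    (ih : ∀ (p q : ℕ) (A' B' : Matrix (Fin p) (Fin q) ℂ),
      p + q < Fintype.card m + Fintype.card n →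
      ∃ L : PencilBlocks, PencilEquiv A' B' L.const L.lead) :
    ∃ L : PencilBlocks, PencilEquiv A B L.const L.lead := by
  obtain ⟨p, q, A', B', h⟩ := h
  have hcard := h.card_eq
  simp only [Fintype.card_sum, Fintype.card_fin] at hcard
  obtain ⟨L, hL⟩ := ih p q A' B' (by omega)
  refine ⟨K.sum L, (h.trans (hK.fromBlocks hL)).trans ?_⟩
  rw [← fromBlocks_const, ← fromBlocks_lead]
  exact PencilEquiv.submatrix _ _ _ _

theorem exists_pencilEquiv (N : ℕ) : ∀ (p q : ℕ) (A B : Matrix (Fin p) (Fin q) ℂ), p + q = N →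
    ∃ K : PencilBlocks, PencilEquiv A B K.const K.lead := by
  induction N using Nat.strong_induction_on with
  | _ N ih =>
    rintro p q A B rfl
    have ih' : ∀ (p' q' : ℕ) (A' B' : Matrix (Fin p') (Fin q') ℂ),
        p' + q' < Fintype.card (Fin p) + Fintype.card (Fin q) →
        ∃ L : PencilBlocks, PencilEquiv A' B' L.const L.lead := fun p' q' A' B' h =>
      ih _ (by simpa using h) p' q' A' B' rfl
    rcases Nat.eq_zero_or_pos (p + q) with h0 | hpos
    · obtain ⟨rfl, rfl⟩ : p = 0 ∧ q = 0 := by omega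
      exact ⟨empty, pencilEquiv_empty A B⟩
    · rcases pencilSplits_of_card_pos A B (by simpa using hpos) with
        ⟨ρ, s, h⟩ | ⟨s, h⟩ | ⟨j, h⟩ | ⟨j, h⟩
      · exact exists_of_splits h (pencilEquiv_singleFinite ρ s) (by simp) ih'
      · exact exists_of_splits h (pencilEquiv_singleInfinite s) (by simp) ih'
      · exact exists_of_splits h (pencilEquiv_singleRight j) (by simp) ih'
      · exact exists_of_splits h (pencilEquiv_singleLeft j) (by simp) ih'

/-- The Kronecker canonical form obtained by numbering the blocks of each kind. -/
noncomputable def toKroneckerForm (K : PencilBlocks) : KroneckerForm where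
  numFin := Fintype.card K.Finite
  eigenvalue i := K.eigenvalue ((Fintype.equivFin K.Finite).symm i)
  finSize i := K.finSize ((Fintype.equivFin K.Finite).symm i)
  finSize_pos _ := K.finSize_pos _
  numInf := Fintype.card K.Infinite
  infSize i := K.infSize ((Fintype.equivFin K.Infinite).symm i)
  infSize_pos _ := K.infSize_pos _
  numRight := Fintype.card K.Right
  right i := K.right ((Fintype.equivFin K.Right).symm i)
  numLeft := Fintype.card K.Left
  left i := K.left ((Fintype.equivFin K.Left).symm i)

/-- The row positions of `K.toKroneckerForm`. -/
noncomputable def rowEquiv (K : PencilBlocks) :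
    K.toKroneckerForm.Reg ⊕ K.toKroneckerForm.SingRow ≃ K.Row :=
  quadSigmaCongr (Fintype.equivFin _).symm (Fintype.equivFin _).symm (Fintype.equivFin _).symm
    (Fintype.equivFin _).symm (fun i => Fin (K.finSize i)) (fun i => Fin (K.infSize i))
    (fun i => Fin (K.right i)) (fun i => Fin (K.left i + 1))

/-- The column positions of `K.toKroneckerForm`. -/
noncomputable def colEquiv (K : PencilBlocks) :
    K.toKroneckerForm.Reg ⊕ K.toKroneckerForm.SingCol ≃ K.Col :=
  quadSigmaCongr (Fintype.equivFin _).symm (Fintype.equivFin _).symm (Fintype.equivFin _).symm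
    (Fintype.equivFin _).symm (fun i => Fin (K.finSize i)) (fun i => Fin (K.infSize i))
    (fun i => Fin (K.right i + 1)) (fun i => Fin (K.left i))

theorem const_submatrix (K : PencilBlocks) : K.const.submatrix K.rowEquiv K.colEquiv =
    fromBlocks K.toKroneckerForm.regConst 0 0 K.toKroneckerForm.singConst := by
  refine (quadDiagonal_congr _ _ _ _ _ _ _ _).trans ?_
  rw [KroneckerForm.regConst, ← blockDiagonal'_one]
  rfl

theorem lead_submatrix (K : PencilBlocks) : K.lead.submatrix K.rowEquiv K.colEquiv =
    fromBlocks K.toKroneckerForm.regLead 0 0 K.toKroneckerForm.singLead := by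
  refine (quadDiagonal_congr _ _ _ _ _ _ _ _).trans ?_
  rw [KroneckerForm.regLead, ← blockDiagonal'_one]
  rfl

end PencilBlocks

theorem KroneckerForm.isFormOf_of_pencilEquiv (K : KroneckerForm) {n m : ℕ}
    {A B : Matrix (Fin n) (Fin m) ℂ} (h : PencilEquiv A B (fromBlocks K.regConst 0 0 K.singConst)
      (fromBlocks K.regLead 0 0 K.singLead)) : K.IsFormOf A B := by
  have h' : PencilEquiv A B K.const K.lead :=
    h.trans (PencilEquiv.submatrix _ _ K.rowEquiv.symm K.colEquiv.symm)
  have hcard := h'.card_eq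
  simp only [Fintype.card_fin] at hcard
  obtain ⟨rfl, rfl⟩ := hcard
  obtain ⟨P, P', Q, Q', h1, -, h3, -, h5, h6⟩ := h'
  exact ⟨P, Q, Matrix.det_ne_zero_of_right_inverse h1, Matrix.det_ne_zero_of_right_inverse h3,
    rfl, rfl, h5, h6⟩

/-- Every pencil has a Kronecker canonical form. -/
theorem KroneckerForm.exists_isFormOf {n m : ℕ} (A B : Matrix (Fin n) (Fin m) ℂ) :
    ∃ K : KroneckerForm, K.IsFormOf A B := by
  obtain ⟨K, hK⟩ := PencilBlocks.exists_pencilEquiv _ n m A B rfl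
  refine ⟨K.toKroneckerForm, K.toKroneckerForm.isFormOf_of_pencilEquiv ?_⟩
  rw [← K.const_submatrix, ← K.lead_submatrix]
  exact hK.trans (PencilEquiv.submatrix _ _ _ _)

/-! ### The regular part and its coupling to the singular part -/

theorem det_blockDiagonal'_ne_zero {ι : Type*} [Fintype ι] [DecidableEq ι] {β : ι → Type*}
    [∀ i, Fintype (β i)] [∀ i, DecidableEq (β i)] {M : ∀ i, Matrix (β i) (β i) ℂ}
    (h : ∀ i, (M i).det ≠ 0) : (blockDiagonal' M).det ≠ 0 := by
  refine Matrix.det_ne_zero_of_right_inverse (B := blockDiagonal' fun i => (M i)⁻¹) ?_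
  rw [← blockDiagonal'_mul, ← blockDiagonal'_one]
  congr 1
  funext i
  exact Matrix.mul_nonsing_inv _ (isUnit_iff_ne_zero.2 (h i))

namespace KroneckerForm

theorem regConst_commute_regLead (K : KroneckerForm) : Commute K.regConst K.regLead := by
  simp [Commute, SemiconjBy, regConst, regLead, Matrix.fromBlocks_multiply]

/-- For `μ` outside the finite set of eigenvalues the matrix is upper triangular within each block,
with diagonal entries `μ - λ_i` or `-1`. -/
theorem exists_det_ne_zero (K : KroneckerForm) :
    ∃ μ : ℂ, (-K.regConst + μ • K.regLead).det ≠ 0 := by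
  obtain ⟨μ, hμ⟩ := (Set.finite_range K.eigenvalue).infinite_compl.nonempty
  refine ⟨μ, ?_⟩
  have h : -K.regConst + μ • K.regLead = fromBlocks
      (blockDiagonal' fun i => -jordanBlock (K.eigenvalue i) (K.finSize i) + μ • 1) 0
      0 (blockDiagonal' fun i => -1 + μ • jordanBlock 0 (K.infSize i)) := by
    have h1 := blockDiagonal'_add (fun i => -jordanBlock (K.eigenvalue i) (K.finSize i))
      (μ • fun _ => 1)
    have h2 := blockDiagonal'_add (fun _ => -1) (μ • fun i => jordanBlock 0 (K.infSize i))
    rw [blockDiagonal'_smul] at h1 h2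
    have h3 := blockDiagonal'_neg fun i => jordanBlock (K.eigenvalue i) (K.finSize i)
    have h4 := blockDiagonal'_neg fun i => (1 : Matrix (Fin (K.infSize i)) (Fin (K.infSize i)) ℂ)
    have h5 := blockDiagonal'_one (α := ℂ) (m' := fun i => Fin (K.finSize i))
    have h6 := blockDiagonal'_one (α := ℂ) (m' := fun i => Fin (K.infSize i))
    rw [regConst, regLead, Matrix.fromBlocks_neg, Matrix.fromBlocks_smul, Matrix.fromBlocks_add]
    congr 1
    · exact (by rw [← h5]; exact (h1.trans (by rw [← h3]; rfl)).symm)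
    · simp
    · simp
    · exact (by rw [← h6]; exact (h2.trans (by erw [h4]; rfl)).symm)
  rw [h, Matrix.det_fromBlocks_zero₂₁]
  refine mul_ne_zero (det_blockDiagonal'_ne_zero fun i => ?_)
    (det_blockDiagonal'_ne_zero fun i => ?_)
  · refine (PencilChain.isUnit_det_of_pairing (fun a b hab => ?_) fun a => ?_).ne_zero
    · have h1 : b ≠ a := hab.ne
      have h2 : (b : ℕ) ≠ a + 1 := by have : (b : ℕ) < a := hab; omega
      simp [jordanBlock, h1, h1.symm, h2]
    · have : μ ≠ K.eigenvalue i := fun h => hμ ⟨i, h.symm⟩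
      simpa [jordanBlock, neg_add_eq_zero] using this.symm
  · refine (PencilChain.isUnit_det_of_pairing (fun a b hab => ?_) fun a => ?_).ne_zero
    · have h1 : b ≠ a := hab.ne
      have h2 : (b : ℕ) ≠ a + 1 := by have : (b : ℕ) < a := hab; omega
      simp [jordanBlock, h1, h1.symm, h2]
    · simp [jordanBlock]

theorem mul_sing_right (K : KroneckerForm) {r : Type*} (X : Matrix r K.SingRow ℂ)
    (hX : ∀ p x, X p (Sum.inl x) = 0) (p : r) (x : Σ i, Fin (K.right i + 1)) :
    (X * K.singConst) p (Sum.inl x) = 0 ∧ (X * K.singLead) p (Sum.inl x) = 0 := by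
  simp [Matrix.mul_apply, singConst, singLead, hX]

theorem mul_singConst_left (K : KroneckerForm) {r : Type*} (X : Matrix r K.SingRow ℂ) (p : r)
    (i : Fin K.numLeft) (a : Fin (K.left i)) :
    (X * K.singConst) p (Sum.inr ⟨i, a⟩) = X p (Sum.inr ⟨i, a.succ⟩) := by
  simp only [Matrix.mul_apply, singConst, Fintype.sum_sum_type, Matrix.fromBlocks_apply₁₂,
    Matrix.fromBlocks_apply₂₂, Matrix.zero_apply, mul_zero, Finset.sum_const_zero, zero_add,
    Fintype.sum_sigma]
  rw [Finset.sum_eq_single i]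
  · simp [blockDiagonal'_apply_eq, kroneckerConst]
  · intro j _ hj
    simp [blockDiagonal'_apply_ne _ _ _ hj]
  · simp

theorem mul_singLead_left (K : KroneckerForm) {r : Type*} (X : Matrix r K.SingRow ℂ) (p : r)
    (i : Fin K.numLeft) (a : Fin (K.left i)) :
    (X * K.singLead) p (Sum.inr ⟨i, a⟩) = X p (Sum.inr ⟨i, a.castSucc⟩) := by
  simp only [Matrix.mul_apply, singLead, Fintype.sum_sum_type, Matrix.fromBlocks_apply₁₂,
    Matrix.fromBlocks_apply₂₂, Matrix.zero_apply, mul_zero, Finset.sum_const_zero, zero_add,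
    Fintype.sum_sigma]
  rw [Finset.sum_eq_single i]
  · simp [blockDiagonal'_apply_eq, kroneckerLead]
  · intro j _ hj
    simp [blockDiagonal'_apply_ne _ _ _ hj]
  · simp

/-- The solutions of `R(λ) Y + X S(λ) = 0` in constant matrices that are supported on the
blocks `L_jᵀ`. -/
theorem exists_coupling (K : KroneckerForm) (z : Fin K.numLeft → K.Reg → ℂ) :
    ∃ (X : Matrix K.Reg K.SingRow ℂ) (Y : Matrix K.Reg K.SingCol ℂ),
      K.regConst * Y + X * K.singConst = 0 ∧ K.regLead * Y + X * K.singLead = 0 ∧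
      (∀ p x, X p (Sum.inl x) = 0) ∧
      ∀ p i (a : Fin (K.left i + 1)), X p (Sum.inr ⟨i, a⟩) =
        ((K.regConst ^ (a : ℕ) * K.regLead ^ (K.left i - a)) *ᵥ z i) p := by
  let X : Matrix K.Reg K.SingRow ℂ := Matrix.of fun p => Sum.elim (fun _ => 0) fun x =>
    ((K.regConst ^ (x.2 : ℕ) * K.regLead ^ (K.left x.1 - x.2)) *ᵥ z x.1) p
  -- For a block `L_jᵀ` the two equations read `C y_a + x_{a+1} = 0` and `D y_a + x_a = 0` for `a <
  -- j`. They hold for `x_a = C^a D^(j-a) z` and `y_a = -C^a D^(j-1-a) z`, the second because `C`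
  -- and `D` commute.
  let y : (Σ i, Fin (K.left i)) → K.Reg → ℂ := fun x =>
    -((K.regConst ^ (x.2 : ℕ) * K.regLead ^ (K.left x.1 - 1 - x.2)) *ᵥ z x.1)
  let Y : Matrix K.Reg K.SingCol ℂ := Matrix.of fun p => Sum.elim (fun _ => 0) fun x => y x p
  have hY : ∀ (R : Matrix K.Reg K.Reg ℂ) p x, (R * Y) p (Sum.inr x) = (R *ᵥ y x) p :=
    fun _ _ _ => rfl
  have hX : ∀ p x, X p (Sum.inl x) = 0 := fun _ _ => rfl
  refine ⟨X, Y, ?_, ?_, hX, fun _ _ _ => rfl⟩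
  · ext p (x | ⟨i, a⟩)
    · rw [Matrix.add_apply, (K.mul_sing_right X hX p x).1]
      simp [Matrix.mul_apply, Y]
    · rw [Matrix.add_apply, mul_singConst_left, hY]
      simp only [y, X, Matrix.of_apply, Sum.elim_inr, Matrix.mulVec_neg, Matrix.mulVec_mulVec,
        ← Matrix.mul_assoc, ← pow_succ', Fin.val_succ, Pi.neg_apply, Matrix.zero_apply,
        Nat.sub_sub, add_comm 1, neg_add_cancel]
  · ext p (x | ⟨i, a⟩)
    · rw [Matrix.add_apply, (K.mul_sing_right X hX p x).2]
      simp [Matrix.mul_apply, Y]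
    · rw [Matrix.add_apply, mul_singLead_left, hY]
      have h1 : K.regLead * (K.regConst ^ (a : ℕ) * K.regLead ^ (K.left i - 1 - a)) =
          K.regConst ^ (a : ℕ) * K.regLead ^ (K.left i - a) := by
        rw [← Matrix.mul_assoc, ← (K.regConst_commute_regLead.pow_left a).eq, Matrix.mul_assoc,
          ← pow_succ', show K.left i - 1 - a + 1 = K.left i - a by omega]
      simp only [y, X, Matrix.of_apply, Sum.elim_inr, Matrix.mulVec_neg, Matrix.mulVec_mulVec,
        h1, Fin.val_castSucc, Pi.neg_apply, Matrix.zero_apply, neg_add_cancel]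

/-- The matrix of the linear map `z ↦ X U`, where `X` is the coupling built from the vectors `z`
for the first `k` of the blocks `L_jᵀ`. -/
noncomputable def couplingMatrix (K : KroneckerForm) {k : ℕ} (hk : k ≤ K.numLeft) {S : Type*}
    [CommRing S] [Algebra ℂ S] (U : Matrix K.SingRow (Fin k) S) :
    Matrix (K.Reg × Fin k) (K.Reg × Fin k) S :=
  Matrix.of fun x y => ∑ a : Fin (K.left (Fin.castLE hk y.2) + 1),
    U (Sum.inr ⟨Fin.castLE hk y.2, a⟩) x.2 * algebraMap ℂ S
      ((K.regConst ^ (a : ℕ) * K.regLead ^ (K.left (Fin.castLE hk y.2) - a)) x.1 y.1)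

theorem exists_coupling_of_det_ne_zero (K : KroneckerForm) {k : ℕ} (hk : k ≤ K.numLeft)
    (U₁ : Matrix K.Reg (Fin k) ℂ) (U₂ : Matrix K.SingRow (Fin k) ℂ)
    (hdet : (K.couplingMatrix hk U₂).det ≠ 0) :
    ∃ (X : Matrix K.Reg K.SingRow ℂ) (Y : Matrix K.Reg K.SingCol ℂ),
      K.regConst * Y + X * K.singConst = 0 ∧ K.regLead * Y + X * K.singLead = 0 ∧
      U₁ + X * U₂ = 0 := by
  set M := K.couplingMatrix hk U₂ with hM
  let w : K.Reg × Fin k → ℂ := M⁻¹ *ᵥ fun x => -U₁ x.1 x.2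
  have hw : M *ᵥ w = fun x => -U₁ x.1 x.2 := by
    rw [Matrix.mulVec_mulVec, Matrix.mul_nonsing_inv _ (isUnit_iff_ne_zero.2 hdet),
      Matrix.one_mulVec]
  -- The solution of the square system gives the vectors for the first `k` left blocks; the
  -- remaining blocks get zero.
  let z : Fin K.numLeft → K.Reg → ℂ :=
    Function.extend (Fin.castLE hk) (fun i q => w (q, i)) 0
  have hinj : Function.Injective (Fin.castLE hk) := Fin.castLE_injective hk
  obtain ⟨X, Y, h1, h2, h3, h4⟩ := K.exists_coupling z
  refine ⟨X, Y, h1, h2, ?_⟩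
  ext p j
  rw [Matrix.add_apply, Matrix.zero_apply, add_comm, ← eq_neg_iff_add_eq_zero]
  refine Eq.trans ?_ (congrFun hw (p, j))
  simp only [Matrix.mul_apply, Fintype.sum_sum_type, h3, zero_mul, Finset.sum_const_zero,
    zero_add, Fintype.sum_sigma, h4]
  rw [Matrix.mulVec, dotProduct, Fintype.sum_prod_type, Finset.sum_comm]
  symm
  refine Fintype.sum_of_injective _ hinj _ _ (fun i hi => ?_) fun i => ?_
  · have hz : z i = 0 := Function.extend_apply' _ _ _ hi
    simp [hz]
  · have hz : z (Fin.castLE hk i) = fun q => w (q, i) := hinj.extend_apply _ _ _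
    simp only [hz, hM, couplingMatrix, Matrix.of_apply, Matrix.mulVec, dotProduct,
      Finset.sum_mul, Algebra.algebraMap_self, RingHom.id_apply]
    rw [Finset.sum_comm]
    refine Finset.sum_congr rfl fun a _ => Finset.sum_congr rfl fun q _ => ?_
    ring

/-! ### Genericity and the adjustment of the transformation -/

theorem exists_couplingMatrix_det_ne_zero (K : KroneckerForm) {k : ℕ} (hk : k ≤ K.numLeft) :
    ∃ U : Matrix K.SingRow (Fin k) ℂ, (K.couplingMatrix hk U).det ≠ 0 := by
  obtain ⟨μ, hμ⟩ := K.exists_det_ne_zero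
  -- Column `j` is supported on the `j`-th left block, which decouples the system; its entries are
  -- the coefficients in the binomial expansion of `(-C + μ D)^(n_j)`.
  let U : Matrix K.SingRow (Fin k) ℂ := Matrix.of fun x j => Sum.elim (fun _ => 0)
    (fun y => if y.1 = Fin.castLE hk j then
      (-1) ^ (y.2 : ℕ) * μ ^ (K.left y.1 - y.2) * (K.left y.1).choose y.2 else 0) x
  have hU : K.couplingMatrix hk U = blockDiagonal fun i : Fin k =>
      (-K.regConst + μ • K.regLead) ^ K.left (Fin.castLE hk i) := by
    ext ⟨p, j⟩ ⟨q, i⟩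
    rw [blockDiagonal_apply]
    simp only [couplingMatrix, Matrix.of_apply, U, Sum.elim_inr, Fin.castLE_inj,
      Algebra.algebraMap_self, RingHom.id_apply, eq_comm (a := i)]
    split_ifs with hji
    · subst hji
      have hc : Commute (-K.regConst) (μ • K.regLead) :=
        (K.regConst_commute_regLead.neg_left).smul_right μ
      rw [hc.add_pow, Matrix.sum_apply, Finset.sum_range]
      refine Finset.sum_congr rfl fun a _ => ?_
      have h : ∀ n b : ℕ, (-K.regConst) ^ b * (μ • K.regLead) ^ (n - b) *
          ((n.choose b : ℕ) : Matrix K.Reg K.Reg ℂ) =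
          ((-1) ^ b * μ ^ (n - b) * (n.choose b : ℂ)) •
            (K.regConst ^ b * K.regLead ^ (n - b)) := by
        intro n b
        rw [← neg_one_smul ℂ K.regConst, smul_pow, smul_pow, smul_mul_smul_comm, ← nsmul_eq_mul',
          ← Nat.cast_smul_eq_nsmul ℂ, smul_smul, mul_comm (n.choose b : ℂ)]
      rw [h, Matrix.smul_apply, smul_eq_mul]
    · simp
  refine ⟨U, ?_⟩
  rw [hU, Matrix.det_blockDiagonal]
  refine Finset.prod_ne_zero_iff.2 fun i _ => ?_
  rw [Matrix.det_pow]
  exact pow_ne_zero _ hμ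

/-- Forming the coupling matrix over the polynomial ring, with the entries of `U` as indeterminates,
exhibits the determinant as one polynomial. Its zero set is proper because the invertible `P` and
the injective `r` let the rows of `P U` selected by `r` be prescribed freely. -/
theorem isGenericSet_det_couplingMatrix (K : KroneckerForm) {n k : ℕ} (hk : k ≤ K.numLeft)
    (P : Matrix (Fin n) (Fin n) ℂ) (hP : P.det ≠ 0) (r : K.SingRow → Fin n)
    (hr : r.Injective) :
    IsGenericMatrixSet {U : Matrix (Fin n) (Fin k) ℂ |
      (K.couplingMatrix hk ((P * U).submatrix r id)).det ≠ 0} := by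
  obtain ⟨p, hp⟩ : ∃ p : MvPolynomial (Fin n × Fin k) ℂ, ∀ x, MvPolynomial.eval x p =
      (K.couplingMatrix hk ((P * Matrix.of fun i j => x (i, j)).submatrix r id)).det := by
    let V : Matrix K.SingRow (Fin k) (MvPolynomial (Fin n × Fin k) ℂ) := Matrix.of fun x j =>
      ∑ l, MvPolynomial.C (P (r x) l) * MvPolynomial.X (l, j)
    refine ⟨(K.couplingMatrix hk V).det, fun x => ?_⟩
    rw [RingHom.map_det]
    congr 1
    ext y y'
    simp [couplingMatrix, V, Matrix.mul_apply, MvPolynomial.algebraMap_eq]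
  refine ⟨{x | ∀ q ∈ ({p} : Finset _), MvPolynomial.eval x q = 0}, ⟨{p}, rfl⟩, ?_, ?_⟩
  · obtain ⟨U, hU⟩ := K.exists_couplingMatrix_det_ne_zero hk
    obtain ⟨W, hW⟩ : ∃ W : Matrix (Fin n) (Fin k) ℂ, (P * W).submatrix r id = U := by
      refine ⟨P⁻¹ * Matrix.of fun i j => Function.extend r (fun x => U x j) 0 i, ?_⟩
      rw [Matrix.mul_nonsing_inv_cancel_left _ _ (isUnit_iff_ne_zero.2 hP)]
      ext x j
      exact hr.extend_apply (fun x => U x j) 0 x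
    intro h
    have h0 := (h.ge (Set.mem_univ fun y => W y.1 y.2)) p (Finset.mem_singleton_self p)
    rw [hp] at h0
    subst hW
    exact hU h0
  · intro x hx q hq
    rw [Finset.mem_singleton.1 hq, hp]
    exact not_not.1 hx

theorem rowEquiv_inr_val (K : KroneckerForm) (x : K.SingRow) :
    K.regSize ≤ (K.rowEquiv (Sum.inr x)).val := by
  exact Nat.le_add_right _ _

theorem exists_isBroughtBy (K : KroneckerForm) {n m k : ℕ} {A B : Matrix (Fin n) (Fin m) ℂ}
    (hK : K.IsFormOf A B) (hk : k ≤ K.numLeft) :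
    ∃ Ω : Set (Matrix (Fin n) (Fin k) ℂ), IsGenericMatrixSet Ω ∧
      ∀ U ∈ Ω, ∃ (P : Matrix (Fin n) (Fin n) ℂ) (Q : Matrix (Fin m) (Fin m) ℂ),
        K.IsBroughtBy A B P Q ∧
        ∀ (i : Fin n) (j : Fin k), i.val < K.regSize → (P * U) i j = 0 := by
  obtain ⟨P₀, Q₀, hP, hQ, rfl, rfl, hA, hB⟩ := hK
  replace hA : P₀ * A * Q₀ = reindex K.rowEquiv K.colEquiv
    (fromBlocks K.regConst 0 0 K.singConst) := hA
  replace hB : P₀ * B * Q₀ = reindex K.rowEquiv K.colEquiv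
    (fromBlocks K.regLead 0 0 K.singLead) := hB
  refine ⟨_, K.isGenericSet_det_couplingMatrix hk P₀ hP (fun x => K.rowEquiv (Sum.inr x))
    (K.rowEquiv.injective.comp Sum.inr_injective), fun U hU => ?_⟩
  obtain ⟨X, Y, h1, h2, h3⟩ := K.exists_coupling_of_det_ne_zero hk
    ((P₀ * U).submatrix (fun x => K.rowEquiv (Sum.inl x)) id) _ hU
  -- The product `L diag(R, S) L'` has upper right block `R Y + X S = 0`, so the canonical form is
  -- preserved, while the upper block of `L P₀ U` becomes `U₁ + X U₂ = 0`.
  let L : Matrix (K.Reg ⊕ K.SingRow) (K.Reg ⊕ K.SingRow) ℂ := fromBlocks 1 X 0 1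
  let L' : Matrix (K.Reg ⊕ K.SingCol) (K.Reg ⊕ K.SingCol) ℂ := fromBlocks 1 Y 0 1
  have key : ∀ {C D : Matrix (Fin (K.regSize + K.singRows)) (Fin (K.regSize + K.singCols)) ℂ}
      {R : Matrix K.Reg K.Reg ℂ} {S : Matrix K.SingRow K.SingCol ℂ},
      D = reindex K.rowEquiv K.colEquiv (fromBlocks R 0 0 S) → P₀ * C * Q₀ = D →
      R * Y + X * S = 0 →
      reindex K.rowEquiv K.rowEquiv L * P₀ * C * (Q₀ * reindex K.colEquiv K.colEquiv L') = D := by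
    rintro C D R S rfl hC hRS
    rw [Matrix.mul_assoc _ P₀ C, ← Matrix.mul_assoc _ Q₀, Matrix.mul_assoc _ (P₀ * C), hC]
    simp only [Matrix.reindex_apply, Matrix.submatrix_mul_equiv, L, L',
      Matrix.fromBlocks_multiply]
    simp [hRS]
  refine ⟨reindex K.rowEquiv K.rowEquiv L * P₀, Q₀ * reindex K.colEquiv K.colEquiv L',
    ⟨?_, ?_, rfl, rfl, key rfl hA h1, key rfl hB h2⟩, fun i j hi => ?_⟩
  · rw [Matrix.det_mul, Matrix.det_reindex_self, Matrix.det_fromBlocks_zero₂₁]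
    simpa using hP
  · rw [Matrix.det_mul, Matrix.det_reindex_self, Matrix.det_fromBlocks_zero₂₁]
    simpa using hQ
  · obtain ⟨x | x, rfl⟩ := K.rowEquiv.surjective i
    · rw [Matrix.mul_assoc, Matrix.mul_apply, ← K.rowEquiv.sum_comp, Fintype.sum_sum_type]
      have h := congrFun (congrFun h3 x) j
      simpa [L, Matrix.one_apply, Matrix.mul_apply (M := X)] using h
    · exact absurd hi (not_lt.2 (K.rowEquiv_inr_val x))

end KroneckerForm

theorem mainTheorem3 (n m k : ℕ) (A B : Matrix (Fin n) (Fin m) ℂ) :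
    (∃ K : KroneckerForm, K.IsFormOf A B) ∧
    ∀ K : KroneckerForm, K.IsFormOf A B → k ≤ K.numLeft →
      ∃ Ω : Set (Matrix (Fin n) (Fin k) ℂ), IsGenericMatrixSet Ω ∧
        ∀ U ∈ Ω, ∃ (P : Matrix (Fin n) (Fin n) ℂ) (Q : Matrix (Fin m) (Fin m) ℂ),
          K.IsBroughtBy A B P Q ∧
          ∀ (i : Fin n) (j : Fin k), i.val < K.regSize → (P * U) i j = 0 :=
  ⟨KroneckerForm.exists_isFormOf A B, fun K hK hk => K.exists_isBroughtBy hK hk⟩
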